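/- Let $p$ be a prime and let $\mathfrak m$ be the Haar measure on $\mathbb{Q}_p$ with $\mathfrak m(\mathbb{Z}_p)=1$. For $x\in\mathbb{Q}_p$ and $n\in\mathbb{Z}$ put $B(x,p^n)=\{y:|y-x|_p\le p^n\}$ and $S(x,p^n)=B(x,p^n)\setminus B(x,p^{n-1})$. Let $\chi(x)=e^{2\pi i\{x\}}$, where $\{x\}$ is the $p$-adic fractional part of $x$, and $\widehat g(\xi)=\int_{\mathbb{Q}_p} g(x)\overline{\chi(\xi x)}\,d\mathfrak m(x)$. Let $\mathcal D$ be the space of compactly supported, uniformly locally constant functions $\mathbb{Q}_p\to\mathbb{C}$ (Bruhat–Schwartz test functions); distributions are the linear functionals on $\mathcal D$ (all of which are continuous), and $\langle\widehat T,\phi\rangle=\langle T,\widehat\phi\rangle$. A locally integrable function $g$ is regarded as the distribution $\phi\mapsto\int g\phi\,d\mathfrak m$. The zero set $\mathcal Z_T$ of a distribution $T$ is the set of all $x$ for which there is $n_0\in\mathbb{Z}$ with $\langle T,1_{B(y,p^n)}\rangle=0$ for all $y\in B(x,p^{n_0})$ and all integers $n\le n_0$. The convolution $S*T$ of two distributions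 is given by $\langle S*T,\phi\rangle=\lim_{k\to\infty}\langle S(x),\langle T(\cdot),1_{B(0,p^k)}(x)\,\phi(x+\cdot)\rangle\rangle$, provided that the limit exists for all $\phi\in\mathcal D$. A set $E\subset\mathbb{Q}_p$ is uniformly discrete if it is countable and there is $\varepsilon>0$ such that $|x-y|_p\ge\varepsilon$ for all distinct $x,y\in E$; then $\mu_E=\sum_{\lambda\in E}\delta_\lambda$ is a distribution. Theorem 3.1. Let $0\le f\in L^1(\mathbb{Q}_p)$ with $\int_{\mathbb{Q}_p} f\,d\mathfrak m>0$, let $E\subset\mathbb{Q}_p$ be uniformly discrete, and suppose that $\mu_E*f$ is well defined and $\mu_E*f=1$ in the sense of distributions. Then: (1) The support of $\widehat f$ is compact. Consequently the integer $n_f:=\min\{n\in\mathbb{Z}:\widehat f(\xi)\ne0\text{ for all }\xi\in B(0,p^{-n})\}$ exists. (2) The set $\mathcal Z_{\widehat{\mu_E}}$ is bounded, and there is a set $K\subset\mathbb{Z}$ such that $$\mathcal Z_{\widehat{\mu_E}}=\bigl(B(0,p^{-n_f})\setminus\{0\}\bigr)\cup\bigcup_{k\in K}S(0,p^k).$$ (3)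 The density $D(E)=\lim_{k\to\infty}\mathrm{Card}(B(x,p^k)\cap E)/\mathfrak m(B(x,p^k))$ exists for every $x\in\mathbb{Q}_p$, does not depend on $x$, and equals $1/\int_{\mathbb{Q}_p} f\,d\mathfrak m$. Moreover, for all integers $n\ge n_f$ and all $\xi\in\mathbb{Q}_p$, $\mathrm{Card}(E\cap B(\xi,p^n))=p^nD(E)$. -/

import Mathlib

open MeasureTheory Filter Topology
open scoped ComplexConjugate

namespace PadicTiling

section Basics

variable (p : ℕ) [Fact p.Prime]

noncomputable instance instMeasurableSpacePadic : MeasurableSpace ℚ_[p] := borel ℚ_[p]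

instance instBorelSpacePadic : BorelSpace ℚ_[p] := ⟨rfl⟩

/-- The unit ball `ℤ_p`, as a compact set with non-empty interior. -/
noncomputable def unitBall : TopologicalSpace.PositiveCompacts ℚ_[p] where
  carrier := Metric.closedBall 0 1
  isCompact' := isCompact_closedBall 0 1
  interior_nonempty' :=
    ⟨0, interior_maximal Metric.ball_subset_closedBall Metric.isOpen_ball
      (Metric.mem_ball_self one_pos)⟩

/-- The Haar measure `𝔪` of `ℚ_p`, normalised by `𝔪(ℤ_p) = 1`. -/
noncomputable def haarQp : Measure ℚ_[p] := Measure.addHaarMeasure (unitBall p)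

instance instIsAddHaarMeasureHaarQp : (haarQp p).IsAddHaarMeasure := by
  unfold haarQp; infer_instance

/-- The closed ball `B(x, p ^ n) = x + p ^ (-n) ℤ_p`. -/
noncomputable def pBall (x : ℚ_[p]) (n : ℤ) : Set ℚ_[p] := Metric.closedBall x ((p : ℝ) ^ n)

/-- The sphere `S(x, p ^ n) = B(x, p ^ n) \ B(x, p ^ (n - 1))`. -/
noncomputable def pSphere (x : ℚ_[p]) (n : ℤ) : Set ℚ_[p] := pBall p x n \ pBall p x (n - 1)

end Basics

section Character

variable {p : ℕ} [Fact p.Prime]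

theorem one_lt_p : (1 : ℝ) < p := by exact_mod_cast (Fact.out : p.Prime).one_lt

theorem p_pos : (0 : ℝ) < p := by linarith [one_lt_p (p := p)]

theorem norm_mul_pow_le (x : ℚ_[p]) : ‖x * (p : ℚ_[p]) ^ (-x.valuation).toNat‖ ≤ 1 := by
  rcases eq_or_ne x 0 with rfl | hx
  · simp
  · rw [norm_mul, Padic.norm_p_pow, Padic.norm_eq_zpow_neg_valuation hx,
      ← zpow_add₀ p_pos.ne']
    apply zpow_le_one_of_nonpos₀ one_lt_p.le
    have := Int.self_le_toNat (-x.valuation)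
    linarith

/-- The fractional part `{x} = ∑_{v(x) ≤ n < 0} a_n p ^ n` of `x = ∑_{n ≥ v(x)} a_n p ^ n`.
For `x ∈ p ^ (-N) ℤ_p` with `N = max(-v(x), 0)`, the natural number `appr (p ^ N x) N` is the
truncation modulo `p ^ N` of the digit expansion of the `p`-adic integer `p ^ N x`. -/
noncomputable def fractPart (x : ℚ_[p]) : ℚ :=
  (PadicInt.appr (⟨x * (p : ℚ_[p]) ^ (-x.valuation).toNat, norm_mul_pow_le x⟩ : ℤ_[p])
    (-x.valuation).toNat : ℚ) / (p : ℚ) ^ (-x.valuation).toNat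

/-- The additive character `χ(x) = exp(2 π i {x})` of `ℚ_p`. -/
noncomputable def chi (x : ℚ_[p]) : ℂ :=
  Complex.exp (2 * Real.pi * Complex.I * ((fractPart x : ℚ) : ℂ))

theorem norm_sub_fractPart (x : ℚ_[p]) : ‖x - ((fractPart x : ℚ) : ℚ_[p])‖ ≤ 1 := by
  have hp : (p : ℚ_[p]) ≠ 0 := by exact_mod_cast (Fact.out : p.Prime).ne_zero
  have h := PadicInt.appr_spec (-x.valuation).toNat
    (⟨x * (p : ℚ_[p]) ^ (-x.valuation).toNat, norm_mul_pow_le x⟩ : ℤ_[p])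
  rw [← PadicInt.norm_le_pow_iff_mem_span_pow, PadicInt.norm_def] at h
  have key : ∀ a n : ℕ, x - (((a : ℚ) / (p : ℚ) ^ n : ℚ) : ℚ_[p])
      = (x * (p : ℚ_[p]) ^ n - a) * ((p : ℚ_[p]) ^ n)⁻¹ := by
    intro a n; push_cast; field_simp
  unfold fractPart
  rw [key, norm_mul, norm_inv, Padic.norm_p_pow]
  refine (mul_le_mul_of_nonneg_right h (by positivity)).trans ?_
  rw [mul_inv_cancel₀ (zpow_ne_zero _ p_pos.ne')]

theorem chi_eq (x : ℚ_[p]) (k : ℤ) (n : ℕ)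
    (h : ‖x - (((k : ℚ) / (p : ℚ) ^ n : ℚ) : ℚ_[p])‖ ≤ 1) :
    chi x = Complex.exp (2 * Real.pi * Complex.I * ((k : ℂ) / (p : ℂ) ^ n)) := by
  have hp : (p : ℚ_[p]) ≠ 0 := by exact_mod_cast (Fact.out : p.Prime).ne_zero
  have hq : (p : ℚ) ≠ 0 := by exact_mod_cast (Fact.out : p.Prime).ne_zero
  have h2 := norm_sub_fractPart x
  obtain ⟨a, m, ham⟩ : ∃ (a : ℤ) (m : ℕ), fractPart x = (a : ℚ) / (p : ℚ) ^ m :=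
    ⟨_, _, by unfold fractPart; rw [Int.cast_natCast]⟩
  rw [ham] at h2
  have h3 : ‖(((a : ℚ) / (p : ℚ) ^ m : ℚ) : ℚ_[p]) - (((k : ℚ) / (p : ℚ) ^ n : ℚ) : ℚ_[p])‖ ≤ 1 := by
    have := (Padic.nonarchimedean (x - (((k : ℚ) / (p : ℚ) ^ n : ℚ) : ℚ_[p]))
      (-(x - (((a : ℚ) / (p : ℚ) ^ m : ℚ) : ℚ_[p])))).trans
      (max_le h (by rwa [norm_neg]))
    refine le_of_eq_of_le ?_ this
    congr 1; ring
  have h4 : ‖((a * (p : ℤ) ^ n - k * (p : ℤ) ^ m : ℤ) : ℚ_[p])‖ ≤ (p : ℝ) ^ (-(n + m : ℕ) : ℤ) := by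
    have e : ((a * (p : ℤ) ^ n - k * (p : ℤ) ^ m : ℤ) : ℚ_[p]) =
        ((((a : ℚ) / (p : ℚ) ^ m : ℚ) : ℚ_[p]) - (((k : ℚ) / (p : ℚ) ^ n : ℚ) : ℚ_[p]))
          * (p : ℚ_[p]) ^ (n + m) := by
      push_cast; rw [pow_add]; field_simp
    rw [e, norm_mul, Padic.norm_p_pow]
    exact mul_le_of_le_one_left (by positivity) h3
  rw [Padic.norm_int_le_pow_iff_dvd] at h4
  obtain ⟨c, hc⟩ := h4
  have hpc : (p : ℂ) ≠ 0 := by exact_mod_cast (Fact.out : p.Prime).ne_zero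
  have hc' : (a : ℂ) * (p : ℂ) ^ n - k * (p : ℂ) ^ m = (p : ℂ) ^ (n + m) * c := by
    exact_mod_cast hc
  unfold chi
  rw [ham, Complex.exp_eq_exp_iff_exists_int]
  refine ⟨c, ?_⟩
  have e2 : (a : ℂ) / (p : ℂ) ^ m = (k : ℂ) / (p : ℂ) ^ n + c := by
    field_simp
    rw [pow_add] at hc'
    linear_combination hc'
  push_cast
  rw [e2]; ring

theorem chi_add (x y : ℚ_[p]) : chi (x + y) = chi x * chi y := by
  have hq : (p : ℚ) ≠ 0 := by exact_mod_cast (Fact.out : p.Prime).ne_zero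
  have hpc : (p : ℂ) ≠ 0 := by exact_mod_cast (Fact.out : p.Prime).ne_zero
  have hx := norm_sub_fractPart x
  have hy := norm_sub_fractPart y
  obtain ⟨a, m, ham⟩ : ∃ (a : ℤ) (m : ℕ), fractPart x = (a : ℚ) / (p : ℚ) ^ m :=
    ⟨_, _, by unfold fractPart; rw [Int.cast_natCast]⟩
  obtain ⟨b, n, hbn⟩ : ∃ (a : ℤ) (m : ℕ), fractPart y = (a : ℚ) / (p : ℚ) ^ m :=
    ⟨_, _, by unfold fractPart; rw [Int.cast_natCast]⟩
  rw [ham] at hx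
  rw [hbn] at hy
  rw [chi_eq x a m hx, chi_eq y b n hy,
    chi_eq (x + y) (a * (p : ℤ) ^ n + b * (p : ℤ) ^ m) (m + n), ← Complex.exp_add]
  · congr 1
    push_cast; rw [pow_add]; field_simp
  · have e : (((a * (p : ℤ) ^ n + b * (p : ℤ) ^ m : ℤ) : ℚ) / (p : ℚ) ^ (m + n) : ℚ)
        = (a : ℚ) / (p : ℚ) ^ m + (b : ℚ) / (p : ℚ) ^ n := by
      push_cast; rw [pow_add]; field_simp
    rw [e, Rat.cast_add, add_sub_add_comm]
    exact (Padic.nonarchimedean _ _).trans (max_le hx hy)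

theorem chi_of_norm_le_one {x : ℚ_[p]} (hx : ‖x‖ ≤ 1) : chi x = 1 := by
  rw [chi_eq x 0 0 (by simpa using hx)]; simp

theorem chi_inv_p_ne_one : chi ((p : ℚ_[p])⁻¹) ≠ 1 := by
  rw [chi_eq _ 1 1 (by simp), Ne, Complex.exp_eq_one_iff]
  rintro ⟨n, hn⟩
  have hpc : (p : ℂ) ≠ 0 := by exact_mod_cast (Fact.out : p.Prime).ne_zero
  have hpi : (2 * Real.pi * Complex.I : ℂ) ≠ 0 := Complex.two_pi_I_ne_zero
  have h1 : (1 : ℂ) / p = n := by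
    apply mul_left_cancel₀ hpi
    rw [mul_comm _ (n : ℂ), ← hn]; simp
  have h2 : (1 : ℂ) = n * p := by rw [← h1]; field_simp
  have h3 : (1 : ℤ) = n * p := by exact_mod_cast h2
  have h4 : (p : ℤ) ∣ 1 := ⟨n, by rw [h3]; ring⟩
  exact (Fact.out : p.Prime).one_lt.ne' (by exact_mod_cast Int.eq_one_of_dvd_one (by positivity) h4)

/-- The Fourier transform `ĝ(ξ) = ∫ g(x) conj(χ(ξ x)) dx` of a function `g` on `ℚ_p`. -/
noncomputable def fourierFun (g : ℚ_[p] → ℂ) (ξ : ℚ_[p]) : ℂ :=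
  ∫ x, g x * conj (chi (ξ * x)) ∂(haarQp p)

end Character

section TestFunctions

variable {p : ℕ} [Fact p.Prime]

/-- Uniformly locally constant functions: `g(x + u) = g(x)` for all `x` and all `u ∈ B(0, p ^ n)`,
for some integer `n`. -/
def IsUniformlyLocallyConstant (g : ℚ_[p] → ℂ) : Prop :=
  ∃ n : ℤ, ∀ x, ∀ u ∈ pBall p 0 n, g (x + u) = g x

theorem mem_pBall_zero {u : ℚ_[p]} {n : ℤ} : u ∈ pBall p 0 n ↔ ‖u‖ ≤ (p : ℝ) ^ n := by
  simp [pBall]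

theorem pBall_mono (x : ℚ_[p]) {m n : ℤ} (h : m ≤ n) : pBall p x m ⊆ pBall p x n :=
  Metric.closedBall_subset_closedBall (zpow_le_zpow_right₀ one_lt_p.le h)

theorem exists_le_zpow (r : ℝ) : ∃ n : ℤ, r ≤ (p : ℝ) ^ n := by
  obtain ⟨n, hn⟩ := pow_unbounded_of_one_lt r (one_lt_p (p := p))
  exact ⟨n, by exact_mod_cast hn.le⟩

theorem IsUniformlyLocallyConstant.continuous {g : ℚ_[p] → ℂ}
    (hg : IsUniformlyLocallyConstant g) : Continuous g := by
  obtain ⟨n, hn⟩ := hg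
  apply IsLocallyConstant.continuous
  rw [IsLocallyConstant.iff_eventually_eq]
  intro x
  filter_upwards [Metric.closedBall_mem_nhds x (zpow_pos (p_pos (p := p)) n)] with y hy
  have := hn x (y - x) (by rw [mem_pBall_zero, ← dist_eq_norm]; exact hy)
  simpa using this

/-- The space `𝓓` of Bruhat-Schwartz test functions: the uniformly locally constant functions
of compact support. -/
def TestFunction (p : ℕ) [Fact p.Prime] : Submodule ℂ (ℚ_[p] → ℂ) where
  carrier := {φ | IsUniformlyLocallyConstant φ ∧ HasCompactSupport φ}
  add_mem' := by
    rintro f g ⟨⟨m, hm⟩, hf⟩ ⟨⟨n, hn⟩, hg⟩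
    refine ⟨⟨min m n, fun x u hu => ?_⟩, hf.add hg⟩
    simp only [Pi.add_apply]
    rw [hm x u (pBall_mono 0 (min_le_left m n) hu), hn x u (pBall_mono 0 (min_le_right m n) hu)]
  zero_mem' := ⟨⟨0, fun _ _ _ => rfl⟩, HasCompactSupport.zero⟩
  smul_mem' := by
    rintro c f ⟨⟨m, hm⟩, hf⟩
    refine ⟨⟨m, fun x u hu => ?_⟩, hf.smul_left (f := fun _ => c)⟩
    simp only [Pi.smul_apply]
    rw [hm x u hu]

theorem continuous_testFunction (φ : TestFunction p) : Continuous (φ : ℚ_[p] → ℂ) :=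
  φ.2.1.continuous

theorem isUniformlyLocallyConstant_chi (ξ : ℚ_[p]) :
    IsUniformlyLocallyConstant (fun x => conj (chi (ξ * x))) := by
  obtain ⟨n, hn⟩ := exists_le_zpow (p := p) ‖ξ‖
  refine ⟨-n, fun x u hu => ?_⟩
  rw [mem_pBall_zero] at hu
  have : ‖ξ * u‖ ≤ 1 := by
    rw [norm_mul]
    refine (mul_le_mul hn hu (norm_nonneg _) (by positivity)).trans ?_
    rw [← zpow_add₀ p_pos.ne', add_neg_cancel, zpow_zero]
  simp only [mul_add, chi_add, chi_of_norm_le_one this, mul_one]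

theorem integrable_mul_chi (φ : TestFunction p) (ξ : ℚ_[p]) :
    Integrable (fun x => (φ : ℚ_[p] → ℂ) x * conj (chi (ξ * x))) (haarQp p) :=
  ((continuous_testFunction φ).mul (isUniformlyLocallyConstant_chi ξ).continuous).integrable_of_hasCompactSupport
    φ.2.2.mul_right

theorem fourierFun_isUniformlyLocallyConstant (φ : TestFunction p) :
    IsUniformlyLocallyConstant (fourierFun (φ : ℚ_[p] → ℂ)) := by
  obtain ⟨r, hr⟩ := φ.2.2.isCompact.isBounded.subset_closedBall 0
  obtain ⟨n, hn⟩ := exists_le_zpow (p := p) r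
  refine ⟨-n, fun ξ u hu => ?_⟩
  rw [mem_pBall_zero] at hu
  unfold fourierFun
  congr 1
  ext x
  by_cases hx : (φ : ℚ_[p] → ℂ) x = 0
  · simp [hx]
  · have hx' : ‖x‖ ≤ (p : ℝ) ^ n := by
      have := hr (subset_tsupport _ hx)
      rw [mem_closedBall_zero_iff] at this
      exact this.trans hn
    have : ‖u * x‖ ≤ 1 := by
      rw [norm_mul]
      refine (mul_le_mul hu hx' (norm_nonneg _) (by positivity)).trans ?_
      rw [← zpow_add₀ p_pos.ne', neg_add_cancel, zpow_zero]
    rw [add_mul, chi_add, chi_of_norm_le_one this, mul_one]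

theorem fourierFun_hasCompactSupport (φ : TestFunction p) :
    HasCompactSupport (fourierFun (φ : ℚ_[p] → ℂ)) := by
  obtain ⟨n, hn⟩ := φ.2.1
  refine HasCompactSupport.intro (isCompact_closedBall (0 : ℚ_[p]) ((p : ℝ) ^ (-n + 1))) ?_
  intro ξ hξ
  rw [mem_closedBall_zero_iff, not_le] at hξ
  have hp : (p : ℚ_[p]) ≠ 0 := by exact_mod_cast (Fact.out : p.Prime).ne_zero
  have hξ0 : ξ ≠ 0 := by
    rintro rfl
    rw [norm_zero] at hξ
    exact absurd hξ (not_lt.2 (zpow_pos p_pos _).le)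
  set u : ℚ_[p] := ξ⁻¹ * (p : ℚ_[p])⁻¹ with hu
  have hξu : ξ * u = (p : ℚ_[p])⁻¹ := by rw [hu]; field_simp
  have hun : u ∈ pBall p 0 n := by
    rw [mem_pBall_zero, hu, norm_mul, norm_inv, norm_inv, Padic.norm_p, inv_inv]
    have h1 : ‖ξ‖⁻¹ ≤ ((p : ℝ) ^ (-n + 1))⁻¹ :=
      inv_anti₀ (zpow_pos p_pos _) hξ.le
    refine (mul_le_mul_of_nonneg_right h1 p_pos.le).trans_eq ?_
    rw [← zpow_neg, ← zpow_add_one₀ p_pos.ne']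
    congr 1; ring
  have key : fourierFun (φ : ℚ_[p] → ℂ) ξ
      = fourierFun (φ : ℚ_[p] → ℂ) ξ * conj (chi (ξ * u)) := by
    conv_lhs => unfold fourierFun
    rw [← integral_add_right_eq_self _ u]
    unfold fourierFun
    rw [← integral_mul_const]
    congr 1
    ext x
    rw [hn x u hun, mul_add, chi_add, map_mul]; ring
  rw [hξu] at key
  by_contra h0
  have h1 : conj (chi ((p : ℚ_[p])⁻¹)) = 1 := by
    apply mul_left_cancel₀ h0
    rw [← key, mul_one]
  apply chi_inv_p_ne_one (p := p)
  have := congrArg conj h1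
  simpa using this

/-- The Fourier transformation `𝓓 → 𝓓`. -/
noncomputable def fourierTest : TestFunction p →ₗ[ℂ] TestFunction p where
  toFun φ := ⟨fourierFun (φ : ℚ_[p] → ℂ),
    fourierFun_isUniformlyLocallyConstant φ, fourierFun_hasCompactSupport φ⟩
  map_add' φ ψ := by
    ext ξ
    change fourierFun _ ξ = fourierFun _ ξ + fourierFun _ ξ
    unfold fourierFun
    rw [← integral_add (integrable_mul_chi φ ξ) (integrable_mul_chi ψ ξ)]
    congr 1
    ext x
    change ((φ : ℚ_[p] → ℂ) x + (ψ : ℚ_[p] → ℂ) x) * _ = _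
    ring
  map_smul' c φ := by
    ext ξ
    change fourierFun _ ξ = c * fourierFun _ ξ
    unfold fourierFun
    rw [← integral_const_mul]
    congr 1
    ext x
    change (c * (φ : ℚ_[p] → ℂ) x) * _ = _
    ring

theorem add_mem_pBall_iff (y x u : ℚ_[p]) {n : ℤ} (hu : u ∈ pBall p 0 n) :
    x + u ∈ pBall p y n ↔ x ∈ pBall p y n := by
  rw [mem_pBall_zero] at hu
  simp only [pBall, Metric.mem_closedBall, dist_eq_norm]
  constructor
  · intro h
    have := (Padic.nonarchimedean (x + u - y) (-u)).trans (max_le h (by rwa [norm_neg]))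
    rwa [show x + u - y + -u = x - y by ring] at this
  · intro h
    have := (Padic.nonarchimedean (x - y) u).trans (max_le h hu)
    rwa [show x - y + u = x + u - y by ring] at this

/-- The indicator function `1_{B(y, p ^ n)}` as a test function. -/
noncomputable def ballIndicator (y : ℚ_[p]) (n : ℤ) : TestFunction p :=
  ⟨(pBall p y n).indicator 1, by
    refine ⟨⟨n, fun x u hu => ?_⟩, ?_⟩
    · have h := add_mem_pBall_iff y x u hu
      by_cases hx : x ∈ pBall p y n
      · rw [Set.indicator_of_mem hx, Set.indicator_of_mem (h.2 hx)]; rfl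
      · rw [Set.indicator_of_notMem hx, Set.indicator_of_notMem (fun h' => hx (h.1 h'))]
    · exact HasCompactSupport.intro (isCompact_closedBall y ((p : ℝ) ^ n))
        fun x hx => Set.indicator_of_notMem hx _⟩

/-- The translate `φ(x + ·)` of a test function. -/
noncomputable def translate (x : ℚ_[p]) (φ : TestFunction p) : TestFunction p :=
  ⟨fun y => (φ : ℚ_[p] → ℂ) (x + y), by
    refine ⟨?_, φ.2.2.comp_homeomorph (Homeomorph.addLeft x)⟩
    obtain ⟨n, hn⟩ := φ.2.1
    exact ⟨n, fun y u hu => by simpa only [add_assoc] using hn (x + y) u hu⟩⟩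

end TestFunctions

section Distributions

variable {p : ℕ} [Fact p.Prime]

/-- Bruhat-Schwartz distributions: the linear functionals on `𝓓` (in the topology of `𝓓` every
linear functional is continuous). -/
abbrev Distribution (p : ℕ) [Fact p.Prime] : Type := TestFunction p →ₗ[ℂ] ℂ

/-- The Fourier transform of a distribution: `⟨T̂, φ⟩ = ⟨T, φ̂⟩`. -/
noncomputable def fourierDist (T : Distribution p) : Distribution p := T ∘ₗ fourierTest

/-- The set `𝓩_T` of zeros of a distribution `T`: the points `x` for which there is an integer
`n₀` with `⟨T, 1_{B(y, p ^ n)}⟩ = 0` for all `y ∈ B(x, p ^ n₀)` and all integers `n ≤ n₀`. -/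
def zeroSet (T : Distribution p) : Set ℚ_[p] :=
  {x | ∃ n₀ : ℤ, ∀ y ∈ pBall p x n₀, ∀ n ≤ n₀, T (ballIndicator y n) = 0}

/-- The distribution `φ ↦ ∫ g φ d𝔪` of a locally integrable function `g`. -/
noncomputable def funDist (g : ℚ_[p] → ℂ) (hg : LocallyIntegrable g (haarQp p)) :
    Distribution p where
  toFun φ := ∫ x, g x * (φ : ℚ_[p] → ℂ) x ∂(haarQp p)
  map_add' φ ψ := by
    have h : ∀ φ : TestFunction p, Integrable (fun x => g x * (φ : ℚ_[p] → ℂ) x) (haarQp p) :=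
      fun φ => by
        simpa only [smul_eq_mul, mul_comm] using
          hg.integrable_smul_left_of_hasCompactSupport (continuous_testFunction φ) φ.2.2
    rw [← integral_add (h φ) (h ψ)]
    congr 1
    ext x
    exact mul_add _ _ _
  map_smul' c φ := by
    rw [RingHom.id_apply, smul_eq_mul, ← integral_const_mul]
    congr 1
    ext x
    exact mul_left_comm _ _ _

/-- Uniformly discrete sets: countable, with a positive lower bound for the distances between
distinct points. -/
def IsUniformlyDiscrete (E : Set ℚ_[p]) : Prop :=
  E.Countable ∧ ∃ ε : ℝ, 0 < ε ∧ ∀ x ∈ E, ∀ y ∈ E, x ≠ y → ε ≤ ‖x - y‖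

theorem IsUniformlyDiscrete.finite_inter {E : Set ℚ_[p]} (hE : IsUniformlyDiscrete E)
    {K : Set ℚ_[p]} (hK : IsCompact K) : (E ∩ K).Finite := by
  obtain ⟨-, ε, hε, h⟩ := hE
  obtain ⟨t, htf, ht⟩ := Metric.totallyBounded_iff.1 hK.totallyBounded (ε / 2) (half_pos hε)
  refine (htf.biUnion (t := fun c => E ∩ Metric.ball c (ε / 2)) fun c _ => ?_).subset ?_
  · refine Set.Subsingleton.finite fun x hx y hy => ?_
    by_contra hxy
    have h1 := h x hx.1 y hy.1 hxy
    rw [← dist_eq_norm] at h1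
    have h2 := dist_triangle_right x y c
    have h3 := Metric.mem_ball.1 hx.2
    have h4 := Metric.mem_ball.1 hy.2
    linarith
  · intro x hx
    obtain ⟨c, hc, hxc⟩ := Set.mem_iUnion₂.1 (ht hx.2)
    exact Set.mem_iUnion₂.2 ⟨c, hc, hx.1, hxc⟩

theorem IsUniformlyDiscrete.finite_support {E : Set ℚ_[p]} (hE : IsUniformlyDiscrete E)
    (φ : TestFunction p) : (E ∩ Function.support (φ : ℚ_[p] → ℂ)).Finite :=
  (hE.finite_inter φ.2.2.isCompact).subset
    (Set.inter_subset_inter_right _ (subset_tsupport _))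

/-- The distribution `μ_E = ∑_{λ ∈ E} δ_λ`, that is `⟨μ_E, φ⟩ = ∑_{λ ∈ E} φ(λ)`, where only
finitely many terms of the sum are non-zero. -/
noncomputable def muDist (E : Set ℚ_[p]) (hE : IsUniformlyDiscrete E) : Distribution p where
  toFun φ := ∑ᶠ x ∈ E, (φ : ℚ_[p] → ℂ) x
  map_add' φ ψ := finsum_mem_add_distrib' (hE.finite_support φ) (hE.finite_support ψ)
  map_smul' c φ := by
    rw [RingHom.id_apply, smul_eq_mul]
    exact (mul_finsum_mem _ c).symm

/-- The test function `x ↦ ⟨T(·), Δ_k(x) φ(x + ·)⟩`, where `Δ_k = 1_{B(0, p ^ k)}`. -/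
noncomputable def convTest (T : Distribution p) (φ : TestFunction p) (k : ℤ) : TestFunction p :=
  ⟨fun x => T (((ballIndicator 0 k : TestFunction p) : ℚ_[p] → ℂ) x • translate x φ), by
    obtain ⟨n, hn⟩ := φ.2.1
    refine ⟨⟨min k n, fun x u hu => ?_⟩, ?_⟩
    · have h1 : ((ballIndicator 0 k : TestFunction p) : ℚ_[p] → ℂ) (x + u)
          = ((ballIndicator 0 k : TestFunction p) : ℚ_[p] → ℂ) x := by
        have h := add_mem_pBall_iff 0 x u (pBall_mono 0 (min_le_left k n) hu)
        change (pBall p 0 k).indicator 1 (x + u) = (pBall p 0 k).indicator 1 x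
        by_cases hx : x ∈ pBall p 0 k
        · rw [Set.indicator_of_mem hx, Set.indicator_of_mem (h.2 hx)]; rfl
        · rw [Set.indicator_of_notMem hx, Set.indicator_of_notMem (fun h' => hx (h.1 h'))]
      have h2 : translate (x + u) φ = translate x φ := by
        ext y
        change (φ : ℚ_[p] → ℂ) (x + u + y) = (φ : ℚ_[p] → ℂ) (x + y)
        rw [add_right_comm]
        exact hn _ u (pBall_mono 0 (min_le_right k n) hu)
      dsimp only
      rw [h1, h2]
    · refine HasCompactSupport.intro (isCompact_closedBall (0 : ℚ_[p]) ((p : ℝ) ^ k)) ?_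
      intro x hx
      have h1 : ((ballIndicator 0 k : TestFunction p) : ℚ_[p] → ℂ) x = 0 :=
        Set.indicator_of_notMem hx _
      rw [h1, zero_smul, map_zero]⟩

/-- `S * T = U` in the sense of distributions: for every test function `φ` the limit
`lim_{k → ∞} ⟨S(x), ⟨T(·), Δ_k(x) φ(x + ·)⟩⟩` exists and equals `⟨U, φ⟩`. -/
def IsConvolution (S T U : Distribution p) : Prop :=
  ∀ φ : TestFunction p, Tendsto (fun k : ℤ => S (convTest T φ k)) atTop (𝓝 (U φ))

/-- `E` has density `D`: for every `x` (equivalently, for some `x`)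
`Card(B(x, p ^ k) ∩ E) / 𝔪(B(x, p ^ k)) → D` as `k → ∞`. -/
def HasDensity (E : Set ℚ_[p]) (D : ℝ) : Prop :=
  ∀ x : ℚ_[p], Tendsto
    (fun k : ℤ => ((pBall p x k ∩ E).ncard : ℝ) / (haarQp p).real (pBall p x k)) atTop (𝓝 D)

/-- The set of integers `n` such that `f̂` has no zero in the ball `B(0, p ^ (-n))`; the integer
`n_f` is its minimum. -/
def nonvanishingRadii (f : ℚ_[p] → ℝ) : Set ℤ :=
  {n | ∀ ξ ∈ pBall p 0 (-n), fourierFun (fun x => (f x : ℂ)) ξ ≠ 0}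

end Distributions

end PadicTiling

open PadicTiling

namespace PadicTiling

variable {p : ℕ} [Fact p.Prime]

/-! Write H(x) for the sum of conj χ(ξλ) over λ ∈ E ∩ B(x, p^n). Testing μ_E * f = 1 against conj
χ(ξ·) 1_{B(x, p^n)} expresses the convolution of f conj χ(ξ·) with H as an explicit multiple of
1_{B(0, p^{-n})}(ξ) (`integral_mul_ballSum`). For ξ ≠ 0 and n large this is zero. Since H is
constant on balls of radius p^n, replacing H(x - y) by H(x) costs at most 2 sup|H| times the mass of
|f| outside B(0, p^n), a mass that tends to 0. If f̂(ξ) ≠ 0, this forces sup|H| = 0 for all large n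
(`eventually_ballSum_eq_zero`). So away from the origin, the non-zero set of f̂ lies in the zero set
of the Fourier transform of μ_E.

The values of χ on a finite set are p-power roots of unity, and multiplying the arguments by a
p-adic unit acts on them as a Galois automorphism. Hence a vanishing exponential sum vanishes on the
whole sphere through ξ (`sum_chi_unit_mul_eq_zero`), and the zero set is a union of spheres.
Integrating the sum over the sphere |ξ| = p^k gives Card(E ∩ B(x, p^{-k+1})) = p Card(E ∩ B(x,
p^{-k})) for all x (`ncard_inter_pBall_succ`).

Both remaining claims follow from this relation. For large k it contradicts uniform discreteness at
a point of E, so the zero set, and with it the support of f̂, is bounded. For the spheres inside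
B(0, p^{-n_f}) it makes the counts grow exactly like c p^n from scale n_f on; the test at ξ = 0 then
yields c ∫ f = 1. -/

theorem p_ne_zero_padic : (p : ℚ_[p]) ≠ 0 := by exact_mod_cast (Fact.out : p.Prime).ne_zero

/-! ### Ultrametric geometry of balls and spheres -/

theorem norm_zpow_p (n : ℤ) : ‖(p : ℚ_[p]) ^ n‖ = (p : ℝ) ^ (-n) := by
  rw [norm_zpow, Padic.norm_p, inv_zpow, zpow_neg]

theorem mem_pBall {x y : ℚ_[p]} {n : ℤ} : x ∈ pBall p y n ↔ ‖x - y‖ ≤ (p : ℝ) ^ n := by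
  rw [pBall, Metric.mem_closedBall, dist_eq_norm]

theorem self_mem_pBall (x : ℚ_[p]) (n : ℤ) : x ∈ pBall p x n := by
  rw [mem_pBall, sub_self, norm_zero]; exact (zpow_pos p_pos n).le

theorem mem_pBall_comm {x y : ℚ_[p]} {n : ℤ} : x ∈ pBall p y n ↔ y ∈ pBall p x n := by
  rw [mem_pBall, mem_pBall, norm_sub_rev]

theorem mem_pBall_congr {x y z : ℚ_[p]} {n : ℤ} (h : x ∈ pBall p y n) :
    z ∈ pBall p x n ↔ z ∈ pBall p y n := by
  rw [mem_pBall] at h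
  rw [mem_pBall_comm, mem_pBall_comm (x := z)]
  have := add_mem_pBall_iff z y (x - y) (mem_pBall_zero.2 h)
  rwa [add_sub_cancel] at this

theorem pBall_eq_of_mem {x y : ℚ_[p]} {n : ℤ} (h : x ∈ pBall p y n) : pBall p x n = pBall p y n :=
  Set.ext fun _ => mem_pBall_congr h

theorem isCompact_pBall (x : ℚ_[p]) (n : ℤ) : IsCompact (pBall p x n) := isCompact_closedBall _ _

theorem measurableSet_pBall (x : ℚ_[p]) (n : ℤ) : MeasurableSet (pBall p x n) :=
  Metric.isClosed_closedBall.measurableSet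

theorem zpow_le_norm_of_lt {x : ℚ_[p]} {n : ℤ} (h : (p : ℝ) ^ n < ‖x‖) : (p : ℝ) ^ (n + 1) ≤ ‖x‖ := by
  by_contra! h'
  exact h.not_ge ((Padic.norm_le_pow_iff_norm_lt_pow_add_one x n).2 h')

theorem norm_eq_zpow {x : ℚ_[p]} (hx : x ≠ 0) : ∃ k : ℤ, ‖x‖ = (p : ℝ) ^ k :=
  ⟨_, Padic.norm_eq_zpow_neg_valuation hx⟩

theorem mem_pSphere_zero {x : ℚ_[p]} {n : ℤ} : x ∈ pSphere p 0 n ↔ ‖x‖ = (p : ℝ) ^ n := by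
  rw [pSphere, Set.mem_sdiff, mem_pBall_zero, mem_pBall_zero, not_le]
  constructor
  · rintro ⟨h1, h2⟩
    refine le_antisymm h1 ?_
    simpa using zpow_le_norm_of_lt h2
  · intro h
    rw [h]
    exact ⟨le_rfl, zpow_lt_zpow_right₀ one_lt_p (by lia)⟩

/-! ### Character values as roots of unity, and the Galois action of units -/

theorem exists_nat_norm_sub_le {u : ℚ_[p]} (hu : ‖u‖ ≤ 1) (M : ℕ) :
    ∃ c < p ^ M, ‖u - (c : ℚ_[p])‖ ≤ (p : ℝ) ^ (-M : ℤ) := by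
  refine ⟨_, PadicInt.appr_lt ⟨u, hu⟩ M, ?_⟩
  have h := PadicInt.appr_spec M (⟨u, hu⟩ : ℤ_[p])
  rw [← PadicInt.norm_le_pow_iff_mem_span_pow, PadicInt.norm_def] at h
  exact_mod_cast h

theorem exists_nat_norm_sub_div_le {z : ℚ_[p]} {M : ℕ} (hz : ‖z‖ ≤ (p : ℝ) ^ M) :
    ∃ a : ℕ, ‖z - (a : ℚ_[p]) / (p : ℚ_[p]) ^ M‖ ≤ 1 := by
  have hp : (p : ℚ_[p]) ≠ 0 := p_ne_zero_padic
  have hpr : (0 : ℝ) < (p : ℝ) ^ M := pow_pos p_pos M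
  have hn : ‖(p : ℚ_[p]) ^ M‖ = ((p : ℝ) ^ M)⁻¹ := by
    rw [Padic.norm_p_pow, zpow_neg, zpow_natCast]
  obtain ⟨a, -, ha⟩ := exists_nat_norm_sub_le (u := z * (p : ℚ_[p]) ^ M) (by
    rw [norm_mul, hn]
    exact mul_inv_le_one_of_le₀ hz hpr.le) M
  refine ⟨a, ?_⟩
  have e : z - (a : ℚ_[p]) / (p : ℚ_[p]) ^ M = (z * (p : ℚ_[p]) ^ M - a) * ((p : ℚ_[p]) ^ M)⁻¹ := by
    field_simp
  rw [e, norm_mul, norm_inv, hn, inv_inv]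
  rw [zpow_neg, zpow_natCast] at ha
  exact (mul_le_mul_of_nonneg_right ha hpr.le).trans_eq (inv_mul_cancel₀ hpr.ne')

theorem chi_eq_pow {z : ℚ_[p]} {a M : ℕ} (h : ‖z - (a : ℚ_[p]) / (p : ℚ_[p]) ^ M‖ ≤ 1) :
    chi z = Complex.exp (2 * Real.pi * Complex.I / (p ^ M : ℕ)) ^ a := by
  rw [chi_eq z a M (by push_cast; exact h), ← Complex.exp_nat_mul]
  congr 1
  push_cast
  ring

/-- Multiplication of the arguments by a unit of `ℤ_p` preserves the vanishing of a finite sum of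
values of `χ`: it acts on the values as a Galois automorphism of a cyclotomic field. -/
theorem sum_chi_unit_mul_eq_zero {ι : Type*} (s : Finset ι) (z : ι → ℚ_[p])
    (h : ∑ i ∈ s, chi (z i) = 0) {u : ℚ_[p]} (hu : ‖u‖ = 1) : ∑ i ∈ s, chi (u * z i) = 0 := by
  have hpp : p.Prime := Fact.out
  -- A common denominator p^M for all z i modulo ℤ_p; M ≥ 1 ensures that an approximation of u
  -- modulo p^M is still prime to p.
  obtain ⟨M, hM, hzM⟩ : ∃ M : ℕ, 1 ≤ M ∧ ∀ i ∈ s, ‖z i‖ ≤ (p : ℝ) ^ M := by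
    obtain ⟨m, hm⟩ := pow_unbounded_of_one_lt (∑ i ∈ s, ‖z i‖) (one_lt_p (p := p))
    refine ⟨m + 1, by lia, fun i hi => ?_⟩
    calc ‖z i‖ ≤ ∑ i ∈ s, ‖z i‖ := Finset.single_le_sum (fun _ _ => norm_nonneg _) hi
      _ ≤ (p : ℝ) ^ m := hm.le
      _ ≤ (p : ℝ) ^ (m + 1) := pow_le_pow_right₀ one_lt_p.le (by lia)
  obtain ⟨c, -, hc⟩ := exists_nat_norm_sub_le hu.le M
  have hcop : Nat.Coprime c (p ^ M) := by
    refine Nat.Coprime.pow_right M ((hpp.coprime_iff_not_dvd.2 fun hd => ?_).symm)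
    have h1 : ‖((c : ℤ) : ℚ_[p])‖ < 1 := Padic.norm_intCast_lt_one_iff.2 (by exact_mod_cast hd)
    have h2 : (p : ℝ) ^ (-M : ℤ) < 1 := zpow_lt_one_of_neg₀ one_lt_p (by lia)
    have h3 := (Padic.nonarchimedean (u - (c : ℚ_[p])) (c : ℚ_[p])).trans_lt
      (max_lt (hc.trans_lt h2) (by exact_mod_cast h1))
    rw [sub_add_cancel, hu] at h3
    exact lt_irrefl _ h3
  have ha : ∀ i, ∃ a : ℕ, i ∈ s → ‖z i - (a : ℚ_[p]) / (p : ℚ_[p]) ^ M‖ ≤ 1 := fun i => by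
    by_cases hi : i ∈ s
    · obtain ⟨a, ha⟩ := exists_nat_norm_sub_div_le (hzM i hi)
      exact ⟨a, fun _ => ha⟩
    · exact ⟨0, fun h => absurd h hi⟩
  choose a ha using ha
  set ζ : ℂ := Complex.exp (2 * Real.pi * Complex.I / (p ^ M : ℕ)) with hζ
  have hprim : IsPrimitiveRoot ζ (p ^ M) :=
    Complex.isPrimitiveRoot_exp _ (pow_ne_zero _ hpp.ne_zero)
  have hchi : ∀ i ∈ s, chi (z i) = ζ ^ a i := fun i hi => chi_eq_pow (ha i hi)
  have hchiu : ∀ i ∈ s, chi (u * z i) = (ζ ^ c) ^ a i := fun i hi => by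
    rw [← pow_mul]
    refine chi_eq_pow ?_
    have e : u * z i - ((c * a i : ℕ) : ℚ_[p]) / (p : ℚ_[p]) ^ M
        = (u - c) * z i + c * (z i - (a i : ℚ_[p]) / (p : ℚ_[p]) ^ M) := by
      push_cast; ring
    rw [e]
    refine (Padic.nonarchimedean _ _).trans (max_le ?_ ?_)
    · rw [norm_mul]
      refine (mul_le_mul hc (hzM i hi) (norm_nonneg _) (zpow_pos p_pos _).le).trans_eq ?_
      rw [zpow_neg, zpow_natCast, inv_mul_cancel₀ (pow_pos p_pos M).ne']
    · rw [norm_mul]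
      refine mul_le_one₀ ?_ (norm_nonneg _) (ha i hi)
      exact_mod_cast Padic.norm_int_le_one (p := p) c
  -- The two sums are P(ζ) and P(ζ^c). As c is prime to p, ζ and ζ^c have the same minimal
  -- polynomial, which divides P.
  set P : Polynomial ℤ := ∑ i ∈ s, Polynomial.X ^ a i with hP
  have hPaeval : ∀ w : ℂ, Polynomial.aeval w P = ∑ i ∈ s, w ^ a i := fun w => by simp [hP]
  have hζP : Polynomial.aeval ζ P = 0 := by
    rw [hPaeval, ← Finset.sum_congr rfl hchi, h]
  obtain ⟨Q, hQ⟩ := minpoly.isIntegrallyClosed_dvd (hprim.isIntegral (pow_pos hpp.pos M)) hζP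
  rw [Finset.sum_congr rfl hchiu, ← hPaeval, hQ, hprim.minpoly_eq_pow_coprime hcop, map_mul,
    minpoly.aeval, zero_mul]

/-! ### Haar measure of balls and Fourier transforms of their indicators -/

theorem haarQp_pBall_eq (y : ℚ_[p]) (n : ℤ) : haarQp p (pBall p y n) = haarQp p (pBall p 0 n) := by
  rw [← measure_preimage_add_right (haarQp p) (-y) (pBall p 0 n)]
  congr 1
  ext x
  rw [Set.mem_preimage, mem_pBall, mem_pBall_zero, sub_eq_add_neg]

/-- The leading digit splits the larger ball into p disjoint translates of the smaller one. -/
theorem haarQp_pBall_succ (n : ℤ) :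
    haarQp p (pBall p 0 (n + 1)) = p * haarQp p (pBall p 0 n) := by
  set π : ℚ_[p] := (p : ℚ_[p]) ^ (-(n + 1)) with hπ
  have hπn : ‖π‖ = (p : ℝ) ^ (n + 1) := by rw [hπ, norm_zpow_p, neg_neg]
  have hπ0 : π ≠ 0 := zpow_ne_zero _ p_ne_zero_padic
  have hun : pBall p 0 (n + 1) = ⋃ i ∈ Finset.range p, pBall p ((i : ℚ_[p]) * π) n := by
    ext x
    simp only [Set.mem_iUnion, Finset.mem_range, exists_prop]
    constructor
    · intro hx
      rw [mem_pBall_zero, ← hπn] at hx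
      obtain ⟨c, hcp, hc⟩ := exists_nat_norm_sub_le (u := x / π) (by
        rw [norm_div]; exact div_le_one_of_le₀ hx (norm_nonneg _)) 1
      refine ⟨c, by simpa using hcp, ?_⟩
      rw [mem_pBall, show x - c * π = (x / π - c) * π by field_simp, norm_mul, hπn]
      refine (mul_le_mul_of_nonneg_right hc (zpow_pos p_pos _).le).trans_eq ?_
      rw [← zpow_add₀ p_pos.ne']
      congr 1
      push_cast
      ring
    · rintro ⟨i, -, hx⟩
      rw [mem_pBall] at hx
      rw [mem_pBall_zero, ← sub_add_cancel x (i * π)]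
      refine (Padic.nonarchimedean _ _).trans (max_le
        (hx.trans (zpow_le_zpow_right₀ one_lt_p.le (by lia))) ?_)
      rw [norm_mul, hπn]
      refine mul_le_of_le_one_left (zpow_pos p_pos _).le ?_
      exact_mod_cast Padic.norm_int_le_one (p := p) i
  rw [hun, measure_biUnion_finset]
  · simp_rw [haarQp_pBall_eq]
    rw [Finset.sum_const, Finset.card_range, nsmul_eq_mul]
  · intro i hi j hj hij
    rw [Finset.coe_range, Set.mem_Iio] at hi hj
    refine Set.disjoint_left.2 fun x hx hx' => ?_
    have h1 : (i : ℚ_[p]) * π ∈ pBall p ((j : ℚ_[p]) * π) n :=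
      (mem_pBall_congr hx').1 (mem_pBall_comm.1 hx)
    rw [mem_pBall, ← sub_mul, norm_mul, hπn] at h1
    have h2 : ‖(i : ℚ_[p]) - j‖ = 1 := by
      have h3 := Padic.norm_intCast_eq_one_iff (p := p) (z := (i : ℤ) - j)
      push_cast at h3
      refine h3.2 ?_
      refine ((Nat.prime_iff_prime_int.1 Fact.out).coprime_iff_not_dvd.2 fun hd => hij ?_).symm
      have h5 := Int.eq_zero_of_abs_lt_dvd hd (by rw [abs_lt]; constructor <;> lia)
      lia
    rw [h2, one_mul] at h1
    exact (zpow_lt_zpow_right₀ (one_lt_p (p := p)) (by lia : n < n + 1)).not_ge h1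
  · exact fun i _ => measurableSet_pBall _ _

theorem haarQp_real_pBall (y : ℚ_[p]) (n : ℤ) : (haarQp p).real (pBall p y n) = (p : ℝ) ^ n := by
  have hs : ∀ n : ℤ, (haarQp p).real (pBall p 0 (n + 1)) = p * (haarQp p).real (pBall p 0 n) :=
    fun n => by
      rw [Measure.real, haarQp_pBall_succ, ENNReal.toReal_mul, ENNReal.toReal_natCast]; rfl
  rw [Measure.real, haarQp_pBall_eq]
  change (haarQp p).real (pBall p 0 n) = _
  induction n using Int.induction_on with
  | zero =>
    have : pBall p (0 : ℚ_[p]) 0 = (unitBall p : Set ℚ_[p]) := by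
      change Metric.closedBall _ _ = Metric.closedBall _ _
      rw [zpow_zero]
    rw [this, Measure.real, haarQp, Measure.addHaarMeasure_self, zpow_zero, ENNReal.toReal_one]
  | succ k ih => rw [hs, ih, zpow_add_one₀ p_pos.ne', mul_comm]
  | pred k ih =>
    have h := hs (-(k : ℤ) - 1)
    rw [sub_add_cancel, ih] at h
    rw [zpow_sub_one₀ p_pos.ne', h, mul_comm, inv_mul_cancel_left₀ p_pos.ne']

theorem ballIndicator_apply (y : ℚ_[p]) (n : ℤ) (x : ℚ_[p]) :
    ((ballIndicator y n : TestFunction p) : ℚ_[p] → ℂ) x = (pBall p y n).indicator 1 x := rfl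

theorem ballIndicator_add (y x : ℚ_[p]) {u : ℚ_[p]} {n : ℤ} (hu : u ∈ pBall p 0 n) :
    ((ballIndicator y n : TestFunction p) : ℚ_[p] → ℂ) (x + u)
      = ((ballIndicator y n : TestFunction p) : ℚ_[p] → ℂ) x := by
  have h := add_mem_pBall_iff y x u hu
  rw [ballIndicator_apply, ballIndicator_apply]
  by_cases hx : x ∈ pBall p y n
  · rw [Set.indicator_of_mem hx, Set.indicator_of_mem (h.2 hx), Pi.one_apply, Pi.one_apply]
  · rw [Set.indicator_of_notMem hx, Set.indicator_of_notMem fun h' => hx (h.1 h')]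

theorem integral_ballIndicator (y : ℚ_[p]) (n : ℤ) :
    ∫ x, ((ballIndicator y n : TestFunction p) : ℚ_[p] → ℂ) x ∂(haarQp p) = (p : ℂ) ^ n := by
  simp_rw [ballIndicator_apply]
  rw [integral_indicator (measurableSet_pBall y n)]
  simp [haarQp_real_pBall]

theorem norm_mul_le_one {x y : ℚ_[p]} {n : ℤ} (hx : ‖x‖ ≤ (p : ℝ) ^ (-n))
    (hy : ‖y‖ ≤ (p : ℝ) ^ n) : ‖x * y‖ ≤ 1 := by
  rw [norm_mul]
  refine (mul_le_mul hx hy (norm_nonneg _) (zpow_pos p_pos _).le).trans_eq ?_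
  rw [← zpow_add₀ p_pos.ne', neg_add_cancel, zpow_zero]

theorem norm_chi (x : ℚ_[p]) : ‖chi x‖ = 1 := by
  rw [chi, show (2 * Real.pi * Complex.I * ((fractPart x : ℚ) : ℂ) : ℂ)
    = ((2 * Real.pi * (fractPart x : ℝ) : ℝ) : ℂ) * Complex.I by push_cast; ring]
  exact Complex.norm_exp_ofReal_mul_I _

theorem chi_eq_of_mem {ξ x y : ℚ_[p]} {n : ℤ} (hξ : ‖ξ‖ ≤ (p : ℝ) ^ (-n)) (h : x ∈ pBall p y n) :
    chi (ξ * x) = chi (ξ * y) := by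
  rw [← add_sub_cancel y x, mul_add, chi_add,
    chi_of_norm_le_one (norm_mul_le_one hξ (mem_pBall.1 h)), mul_one]

/-- On the dual ball the character is constant on the support of the indicator. Off it, some
translation preserving the ball multiplies the integral by a number other than 1. -/
theorem fourierFun_ballIndicator (y : ℚ_[p]) (n : ℤ) (ξ : ℚ_[p]) :
    fourierFun ((ballIndicator y n : TestFunction p) : ℚ_[p] → ℂ) ξ
      = (p : ℂ) ^ n * conj (chi (ξ * y)) * (pBall p 0 (-n)).indicator 1 ξ := by
  by_cases hξ : ξ ∈ pBall p 0 (-n)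
  · rw [Set.indicator_of_mem hξ, Pi.one_apply, mul_one, ← integral_ballIndicator y n,
      ← integral_mul_const]
    unfold fourierFun
    congr 1
    ext x
    rw [ballIndicator_apply]
    by_cases hx : x ∈ pBall p y n
    · rw [chi_eq_of_mem (mem_pBall_zero.1 hξ) hx]
    · rw [Set.indicator_of_notMem hx, zero_mul, zero_mul]
  · rw [Set.indicator_of_notMem hξ, mul_zero]
    rw [mem_pBall_zero, not_le] at hξ
    have hξ0 : ξ ≠ 0 := by
      rintro rfl
      rw [norm_zero] at hξ
      exact hξ.not_gt (zpow_pos p_pos _)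
    -- Chosen so that χ(ξu) = χ(1/p) ≠ 1. Norms being powers of p, |ξ| > p^{-n} means |ξ| ≥
    -- p^{-n+1}, which just suffices for |u| ≤ p^n.
    set u : ℚ_[p] := ξ⁻¹ * (p : ℚ_[p])⁻¹ with hu
    have hξu : ξ * u = (p : ℚ_[p])⁻¹ := by rw [hu, mul_inv_cancel_left₀ hξ0]
    have hun : u ∈ pBall p 0 n := by
      rw [mem_pBall_zero, hu, norm_mul, norm_inv, norm_inv, Padic.norm_p, inv_inv]
      refine (mul_le_mul_of_nonneg_right
        (inv_anti₀ (zpow_pos p_pos _) (zpow_le_norm_of_lt hξ)) p_pos.le).trans_eq ?_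
      rw [← zpow_neg, ← zpow_add_one₀ p_pos.ne']
      congr 1
      ring
    have key : fourierFun ((ballIndicator y n : TestFunction p) : ℚ_[p] → ℂ) ξ
        = fourierFun ((ballIndicator y n : TestFunction p) : ℚ_[p] → ℂ) ξ * conj (chi (ξ * u)) := by
      conv_lhs => unfold fourierFun
      rw [← integral_add_right_eq_self _ u]
      unfold fourierFun
      rw [← integral_mul_const]
      congr 1
      ext x
      rw [ballIndicator_add y x hun, mul_add, chi_add, map_mul, mul_assoc]
    by_contra h0
    have h1 : conj (chi (ξ * u)) = 1 := mul_left_cancel₀ h0 (by rw [← key, mul_one])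
    apply chi_inv_p_ne_one (p := p)
    have := congrArg conj h1
    rwa [hξu, Complex.conj_conj, map_one] at this

/-! ### From vanishing exponential sums to equidistribution -/

/-- The integral of `χ(ξ λ)` over the sphere `|ξ| = p ^ k`, tested on a finite set: if a finite
exponential sum vanishes at one point of the sphere, then it vanishes on the sphere, and hence the
points of the finite set are equidistributed in balls at the dual scale. -/
theorem card_ball_succ_of_sum_eq_zero (F : Finset ℚ_[p]) {ξ : ℚ_[p]} {k : ℤ}
    (hξ : ‖ξ‖ = (p : ℝ) ^ k) (h : ∑ l ∈ F, chi (ξ * l) = 0) (x : ℚ_[p]) :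
    ((↑F ∩ pBall p x (-k + 1)).ncard : ℂ) = p * ((↑F ∩ pBall p x (-k)).ncard : ℂ) := by
  classical
  have hsum : ∀ η : ℚ_[p], ‖η‖ = (p : ℝ) ^ k → ∑ l ∈ F, chi (η * l) = 0 := by
    intro η hη
    have hξ0 : ξ ≠ 0 := by
      rw [← norm_ne_zero_iff, hξ]; exact (zpow_pos p_pos _).ne'
    have := sum_chi_unit_mul_eq_zero F (fun l => ξ * l) h (u := η / ξ) (by
      rw [norm_div, hη, hξ, div_self (zpow_pos p_pos _).ne'])
    rw [← this]
    refine Finset.sum_congr rfl fun l _ => ?_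
    rw [← mul_assoc, div_mul_cancel₀ _ hξ0]
  -- The transform of 1_{B(0, p^n)} is p^n times the indicator of the dual ball, so summing it over
  -- F - x counts points of F near x.
  have hball : ∀ n : ℤ, ∑ l ∈ F, fourierFun ((ballIndicator 0 n : TestFunction p) : ℚ_[p] → ℂ) (l - x)
      = (p : ℂ) ^ n * ((↑F ∩ pBall p x (-n)).ncard : ℂ) := by
    intro n
    have e : (↑F ∩ pBall p x (-n) : Set ℚ_[p]) = ↑(F.filter (· ∈ pBall p x (-n))) := by
      ext l; simp
    rw [e, Set.ncard_coe_finset, Finset.card_filter, Nat.cast_sum, Finset.mul_sum]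
    refine Finset.sum_congr rfl fun l _ => ?_
    rw [fourierFun_ballIndicator, mul_zero, chi_of_norm_le_one (by simp), map_one, mul_one,
      Set.indicator_apply, mem_pBall_zero, mem_pBall]
    split_ifs <;> simp
  -- The difference of the two sides integrates the exponential sum, up to a phase, over the sphere
  -- |η| = p^k, where it vanishes identically.
  have hdiff : ∑ l ∈ F, fourierFun ((ballIndicator 0 k : TestFunction p) : ℚ_[p] → ℂ) (l - x)
      = ∑ l ∈ F, fourierFun ((ballIndicator 0 (k - 1) : TestFunction p) : ℚ_[p] → ℂ) (l - x) := by
    rw [← sub_eq_zero, ← Finset.sum_sub_distrib]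
    unfold fourierFun
    simp_rw [← integral_sub (integrable_mul_chi (ballIndicator 0 k : TestFunction p) _)
      (integrable_mul_chi (ballIndicator 0 (k - 1) : TestFunction p) _)]
    rw [← integral_finsetSum]
    · rw [← integral_zero ℚ_[p] ℂ (μ := haarQp p)]
      congr 1
      ext η
      simp_rw [← sub_mul]
      rw [← Finset.mul_sum]
      by_cases hη : η ∈ pSphere p 0 k
      · have h0 : ∑ l ∈ F, conj (chi ((l - x) * η)) = 0 := by
          have e : ∀ l ∈ F, conj (chi ((l - x) * η)) = conj (chi (η * l)) * conj (chi (-(x * η))) :=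
            fun l _ => by rw [← map_mul, ← chi_add]; congr 2; ring
          rw [Finset.sum_congr rfl e, ← Finset.sum_mul, ← map_sum, hsum η (mem_pSphere_zero.1 hη),
            map_zero, zero_mul]
        rw [h0, mul_zero]
      · have h0 : ((ballIndicator 0 k : TestFunction p) : ℚ_[p] → ℂ) η
            = ((ballIndicator 0 (k - 1) : TestFunction p) : ℚ_[p] → ℂ) η := by
          rw [ballIndicator_apply, ballIndicator_apply]
          by_cases h1 : η ∈ pBall p 0 (k - 1)
          · rw [Set.indicator_of_mem h1, Set.indicator_of_mem (pBall_mono 0 (by lia) h1)]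
          · rw [Set.indicator_of_notMem h1,
              Set.indicator_of_notMem fun h2 => hη ⟨h2, h1⟩]
        rw [h0, sub_self, zero_mul]
    · exact fun l _ => (integrable_mul_chi (ballIndicator 0 k : TestFunction p) _).sub
        (integrable_mul_chi (ballIndicator 0 (k - 1) : TestFunction p) _)
  rw [hball, hball] at hdiff
  have hpc : (p : ℂ) ≠ 0 := by exact_mod_cast (Fact.out : p.Prime).ne_zero
  rw [show -(k - 1) = -k + 1 by ring] at hdiff
  apply mul_left_cancel₀ (zpow_ne_zero (k - 1) hpc)
  rw [← hdiff, ← mul_assoc, ← zpow_add_one₀ hpc, sub_add_cancel]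

/-! ### Uniform counting bounds and the convolution equation as an integral -/

theorem IsUniformlyDiscrete.finite_inter_pBall {E : Set ℚ_[p]} (hE : IsUniformlyDiscrete E)
    (x : ℚ_[p]) (n : ℤ) : (E ∩ pBall p x n).Finite := hE.finite_inter (isCompact_pBall x n)

/-- Translating by -x moves everything into B(0, p^n), so one finite cover by balls of radius ε/2,
each holding at most one translated point, serves all x. -/
theorem IsUniformlyDiscrete.exists_ncard_le {E : Set ℚ_[p]} (hE : IsUniformlyDiscrete E) (n : ℤ) :
    ∃ C : ℕ, ∀ x, (E ∩ pBall p x n).ncard ≤ C := by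
  obtain ⟨-, ε, hε, h⟩ := hE
  obtain ⟨t, htf, ht⟩ := Metric.totallyBounded_iff.1 (isCompact_pBall (0 : ℚ_[p]) n).totallyBounded
    (ε / 2) (half_pos hε)
  refine ⟨t.ncard, fun x => ?_⟩
  have hc : ∀ l ∈ E ∩ pBall p x n, ∃ c ∈ t, dist (l - x) c < ε / 2 := fun l hl => by
    have := ht (mem_pBall_zero.2 (mem_pBall.1 hl.2))
    simpa using this
  choose! c hct hc using hc
  refine Set.ncard_le_ncard_of_injOn c hct (fun a ha b hb hab => ?_) htf
  by_contra hne
  have h1 := hc a ha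
  have h2 := hc b hb
  rw [← hab] at h2
  have h3 := dist_triangle_right (a - x) (b - x) (c a)
  rw [dist_sub_right, dist_eq_norm] at h3
  linarith [h a ha.1 b hb.1 hne]

theorem exists_support_subset_pBall (φ : TestFunction p) :
    ∃ n : ℤ, ∀ x, (φ : ℚ_[p] → ℂ) x ≠ 0 → x ∈ pBall p 0 n := by
  obtain ⟨r, hr⟩ := φ.2.2.isCompact.isBounded.subset_closedBall 0
  obtain ⟨n, hn⟩ := exists_le_zpow (p := p) r
  exact ⟨n, fun x hx => mem_pBall_zero.2
    ((mem_closedBall_zero_iff.1 (hr (subset_tsupport _ hx))).trans hn)⟩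

/-- Supplies the dominating constant for the limit that defines the convolution: the number of
non-zero terms is bounded independently of y and of the truncation F. -/
theorem exists_norm_sum_translate_le {E : Set ℚ_[p]} (hE : IsUniformlyDiscrete E)
    (φ : TestFunction p) :
    ∃ C : ℝ, ∀ (F : Finset ℚ_[p]), ↑F ⊆ E → ∀ y, ‖∑ l ∈ F, (φ : ℚ_[p] → ℂ) (l + y)‖ ≤ C := by
  classical
  obtain ⟨n, hn⟩ := exists_support_subset_pBall φ
  obtain ⟨C, hC⟩ := hE.exists_ncard_le n
  obtain ⟨M, hM⟩ := φ.2.2.exists_bound_of_continuous (continuous_testFunction φ)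
  have hM0 : 0 ≤ M := (norm_nonneg _).trans (hM 0)
  refine ⟨C * M, fun F hF y => ?_⟩
  have hsub : ∑ l ∈ F, (φ : ℚ_[p] → ℂ) (l + y)
      = ∑ l ∈ F.filter (· ∈ pBall p (-y) n), (φ : ℚ_[p] → ℂ) (l + y) := by
    rw [Finset.sum_filter_of_ne]
    intro l _ hl
    have := hn _ hl
    rwa [mem_pBall_zero, ← sub_neg_eq_add, ← mem_pBall] at this
  rw [hsub]
  refine (norm_sum_le_of_le _ fun l _ => hM (l + y)).trans ?_
  rw [Finset.sum_const, nsmul_eq_mul]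
  refine mul_le_mul_of_nonneg_right ?_ hM0
  have h1 : (F.filter (· ∈ pBall p (-y) n)).card ≤ (E ∩ pBall p (-y) n).ncard := by
    rw [← Set.ncard_coe_finset]
    refine Set.ncard_le_ncard (fun l hl => ?_) (hE.finite_inter_pBall _ n)
    rw [Finset.mem_coe, Finset.mem_filter] at hl
    exact ⟨hF hl.1, hl.2⟩
  exact_mod_cast h1.trans (hC _)

theorem muDist_apply {E : Set ℚ_[p]} (hE : IsUniformlyDiscrete E) (φ : TestFunction p) :
    muDist E hE φ = ∑ᶠ l ∈ E, (φ : ℚ_[p] → ℂ) l := rfl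

theorem translate_apply (x y : ℚ_[p]) (φ : TestFunction p) :
    ((translate x φ : TestFunction p) : ℚ_[p] → ℂ) y = (φ : ℚ_[p] → ℂ) (x + y) := rfl

/-- A finite sum over the points of `E` in a large ball computes `⟨μ_E, φ⟩`. -/
theorem muDist_eq_sum {E : Set ℚ_[p]} (hE : IsUniformlyDiscrete E) (φ : TestFunction p) {x : ℚ_[p]}
    {n : ℤ} (h : ∀ l, (φ : ℚ_[p] → ℂ) l ≠ 0 → l ∈ pBall p x n) :
    muDist E hE φ = ∑ l ∈ (hE.finite_inter_pBall x n).toFinset, (φ : ℚ_[p] → ℂ) l := by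
  rw [muDist_apply, ← finsum_mem_eq_finite_toFinset_sum]
  refine finsum_mem_inter_support_eq _ _ _ ?_
  ext l
  simp only [Set.mem_inter_iff, Function.mem_support]
  exact ⟨fun hl => ⟨⟨hl.1, h l hl.2⟩, hl.2⟩, fun hl => ⟨hl.1.1, hl.2⟩⟩

theorem integrable_mul_translate {g : ℚ_[p] → ℂ} (hg : LocallyIntegrable g (haarQp p))
    (φ : TestFunction p) (x : ℚ_[p]) :
    Integrable (fun y => g y * (φ : ℚ_[p] → ℂ) (x + y)) (haarQp p) := by
  simp_rw [← translate_apply]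
  simpa only [smul_eq_mul, mul_comm] using
    hg.integrable_smul_left_of_hasCompactSupport (continuous_testFunction (translate x φ))
      (translate x φ).2.2

/-- The cutoff leaves only the points of E in B(0, p^k), and a finite sum passes through the
integral. -/
theorem muDist_convTest {E : Set ℚ_[p]} (hE : IsUniformlyDiscrete E) {g : ℚ_[p] → ℂ}
    (hg : LocallyIntegrable g (haarQp p)) (φ : TestFunction p) (k : ℤ) :
    muDist E hE (convTest (funDist g hg) φ k)
      = ∫ y, g y * ∑ l ∈ (hE.finite_inter_pBall 0 k).toFinset, (φ : ℚ_[p] → ℂ) (l + y)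
          ∂(haarQp p) := by
  have happ : ∀ l, ((convTest (funDist g hg) φ k : TestFunction p) : ℚ_[p] → ℂ) l
      = ((ballIndicator 0 k : TestFunction p) : ℚ_[p] → ℂ) l *
        ∫ y, g y * (φ : ℚ_[p] → ℂ) (l + y) ∂(haarQp p) := fun l =>
    (map_smul (funDist g hg) _ (translate l φ))
  rw [muDist_eq_sum hE _ (x := 0) (n := k)]
  · simp_rw [Finset.mul_sum]
    rw [integral_finsetSum _ fun l _ => integrable_mul_translate hg φ l]
    refine Finset.sum_congr rfl fun l hl => ?_
    rw [Set.Finite.mem_toFinset] at hl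
    rw [happ, ballIndicator_apply, Set.indicator_of_mem hl.2, Pi.one_apply, one_mul]
  · intro l hl
    by_contra h
    rw [happ, ballIndicator_apply, Set.indicator_of_notMem h, zero_mul] at hl
    exact hl rfl

/-- If `μ_E * f = 1` with `f` integrable, then `∫ f(y) ⟨μ_E, φ(y + ·)⟩ dy = ∫ φ`. -/
theorem integral_mul_muDist_translate {g : ℚ_[p] → ℂ} (hg : Integrable g (haarQp p))
    {E : Set ℚ_[p]} (hE : IsUniformlyDiscrete E)
    (hconv : IsConvolution (muDist E hE) (funDist g hg.locallyIntegrable)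
      (funDist (fun _ => 1) (locallyIntegrable_const 1))) (φ : TestFunction p) :
    ∫ y, g y * muDist E hE (translate y φ) ∂(haarQp p) = ∫ y, (φ : ℚ_[p] → ℂ) y ∂(haarQp p) := by
  obtain ⟨C, hC⟩ := exists_norm_sum_translate_le hE φ
  obtain ⟨n, hn⟩ := exists_support_subset_pBall φ
  have h1 := hconv φ
  simp_rw [muDist_convTest] at h1
  have h2 : Tendsto (fun k : ℤ => ∫ y, g y *
      ∑ l ∈ (hE.finite_inter_pBall 0 k).toFinset, (φ : ℚ_[p] → ℂ) (l + y) ∂(haarQp p)) atTop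
      (𝓝 (∫ y, g y * muDist E hE (translate y φ) ∂(haarQp p))) := by
    refine tendsto_integral_filter_of_dominated_convergence (fun y => ‖g y‖ * C) ?_ ?_
      (hg.norm.mul_const C) ?_
    · refine Eventually.of_forall fun k => hg.aestronglyMeasurable.mul ?_
      refine Continuous.aestronglyMeasurable ?_
      exact continuous_finsetSum _ fun l _ =>
        (continuous_testFunction φ).comp (continuous_const.add continuous_id)
    · refine Eventually.of_forall fun k => Eventually.of_forall fun y => ?_
      rw [norm_mul]
      refine mul_le_mul_of_nonneg_left (hC _ ?_ y) (norm_nonneg _)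
      intro l hl
      rw [Set.Finite.coe_toFinset] at hl
      exact hl.1
    · refine Eventually.of_forall fun y => Tendsto.const_mul _ ?_
      obtain ⟨m, hm⟩ := exists_le_zpow (p := p) ‖y‖
      -- For fixed y the truncated sums are eventually constant: once B(0, p^k) contains y and the
      -- support of φ, it contains every l with φ(y + l) ≠ 0.
      refine tendsto_const_nhds.congr' ?_
      filter_upwards [eventually_ge_atTop (max m n)] with k hk
      rw [muDist_eq_sum hE (translate y φ) (x := 0) (n := k)]
      · refine Finset.sum_congr rfl fun l _ => ?_
        rw [translate_apply, add_comm]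
      · intro l hl
        have hl' := pBall_mono 0 ((le_max_right m n).trans hk) (hn _ hl)
        rw [mem_pBall_zero] at hl' ⊢
        have := (Padic.nonarchimedean (y + l) (-y)).trans (max_le hl' (by
          rw [norm_neg]
          exact hm.trans (zpow_le_zpow_right₀ one_lt_p.le ((le_max_left m n).trans hk))))
        rwa [add_neg_cancel_comm] at this
  have h3 := tendsto_nhds_unique h2 h1
  rw [h3]
  change ∫ y, (1 : ℂ) * _ ∂(haarQp p) = _
  simp_rw [one_mul]

/-! ### Exponential sums of E over balls -/

/-- The exponential sum `∑ conj χ(ξ λ)` over the points `λ` of `E` in the ball `B(x, p ^ n)`. -/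
noncomputable def ballSum (E : Set ℚ_[p]) (ξ : ℚ_[p]) (n : ℤ) (x : ℚ_[p]) : ℂ :=
  ∑ᶠ l ∈ E ∩ pBall p x n, conj (chi (ξ * l))

theorem ballSum_eq_sum {E : Set ℚ_[p]} (hE : IsUniformlyDiscrete E) (ξ : ℚ_[p]) (n : ℤ)
    (x : ℚ_[p]) :
    ballSum E ξ n x = ∑ l ∈ (hE.finite_inter_pBall x n).toFinset, conj (chi (ξ * l)) :=
  finsum_mem_eq_finite_toFinset_sum _ _

theorem ballSum_zero {E : Set ℚ_[p]} (hE : IsUniformlyDiscrete E) (n : ℤ) (x : ℚ_[p]) :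
    ballSum E 0 n x = ((E ∩ pBall p x n).ncard : ℂ) := by
  rw [ballSum_eq_sum hE, Set.ncard_eq_toFinset_card _ (hE.finite_inter_pBall x n)]
  simp [chi_of_norm_le_one]

theorem exists_norm_ballSum_le {E : Set ℚ_[p]} (hE : IsUniformlyDiscrete E) (n : ℤ) :
    ∃ C : ℝ, ∀ ξ x, ‖ballSum E ξ n x‖ ≤ C := by
  obtain ⟨C, hC⟩ := hE.exists_ncard_le n
  refine ⟨C, fun ξ x => ?_⟩
  rw [ballSum_eq_sum hE]
  refine (norm_sum_le_of_le (n := fun _ => 1) _ fun l _ => ?_).trans ?_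
  · rw [RCLike.norm_conj, norm_chi]
  · have := hC x
    rw [Set.ncard_eq_toFinset_card _ (hE.finite_inter_pBall x n)] at this
    rw [Finset.sum_const, nsmul_eq_mul, mul_one]
    exact_mod_cast this

theorem ballSum_eq_of_mem {E : Set ℚ_[p]} {ξ x y : ℚ_[p]} {n : ℤ} (h : x ∈ pBall p y n) :
    ballSum E ξ n x = ballSum E ξ n y := by
  rw [ballSum, pBall_eq_of_mem h, ballSum]

theorem continuous_ballSum (E : Set ℚ_[p]) (ξ : ℚ_[p]) (n : ℤ) : Continuous (ballSum E ξ n) := by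
  refine IsUniformlyLocallyConstant.continuous ⟨n, fun x u hu => ballSum_eq_of_mem ?_⟩
  rw [mem_pBall, add_sub_cancel_left]
  exact mem_pBall_zero.1 hu

/-- The test function `conj χ(ξ ·) 1_{B(x, p ^ n)}`. -/
noncomputable def modulatedBall (ξ x : ℚ_[p]) (n : ℤ) : TestFunction p :=
  ⟨fun z => ((ballIndicator x n : TestFunction p) : ℚ_[p] → ℂ) z * conj (chi (ξ * z)), by
    obtain ⟨m, hm⟩ := isUniformlyLocallyConstant_chi ξ
    refine ⟨⟨min n m, fun z u hu => ?_⟩, (ballIndicator x n).2.2.mul_right⟩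
    dsimp only
    rw [ballIndicator_add x z (pBall_mono 0 (min_le_left n m) hu)]
    congr 1
    exact hm z u (pBall_mono 0 (min_le_right n m) hu)⟩

theorem muDist_translate_modulatedBall {E : Set ℚ_[p]} (hE : IsUniformlyDiscrete E)
    (ξ x y : ℚ_[p]) (n : ℤ) :
    muDist E hE (translate y (modulatedBall ξ x n)) = conj (chi (ξ * y)) * ballSum E ξ n (x - y) := by
  have happ : ∀ l, ((translate y (modulatedBall ξ x n) : TestFunction p) : ℚ_[p] → ℂ) l
      = (pBall p x n).indicator 1 (y + l) * conj (chi (ξ * (y + l))) := fun _ => rfl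
  have hmem : ∀ l, y + l ∈ pBall p x n ↔ l ∈ pBall p (x - y) n := fun l => by
    rw [mem_pBall, mem_pBall, show l - (x - y) = y + l - x by ring]
  rw [muDist_eq_sum hE _ (x := x - y) (n := n), ballSum_eq_sum hE, Finset.mul_sum]
  · refine Finset.sum_congr rfl fun l hl => ?_
    rw [Set.Finite.mem_toFinset] at hl
    rw [happ, Set.indicator_of_mem ((hmem l).2 hl.2), Pi.one_apply, one_mul, mul_add, chi_add,
      map_mul]
  · intro l hl
    by_contra h
    rw [happ, Set.indicator_of_notMem (fun h' => h ((hmem l).1 h')), zero_mul] at hl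
    exact hl rfl

/-- The convolution of `g conj χ(ξ ·)` with the exponential sums of `E` at scale `p ^ n`. -/
theorem integral_mul_ballSum {g : ℚ_[p] → ℂ} (hg : Integrable g (haarQp p))
    {E : Set ℚ_[p]} (hE : IsUniformlyDiscrete E)
    (hconv : IsConvolution (muDist E hE) (funDist g hg.locallyIntegrable)
      (funDist (fun _ => 1) (locallyIntegrable_const 1))) (ξ x : ℚ_[p]) (n : ℤ) :
    ∫ y, g y * conj (chi (ξ * y)) * ballSum E ξ n (x - y) ∂(haarQp p)
      = (p : ℂ) ^ n * conj (chi (ξ * x)) * (pBall p 0 (-n)).indicator 1 ξ := by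
  have h := integral_mul_muDist_translate hg hE hconv (modulatedBall ξ x n)
  simp_rw [muDist_translate_modulatedBall, ← mul_assoc] at h
  rw [h, ← fourierFun_ballIndicator]
  rfl

theorem integrable_mul_conj_chi {g : ℚ_[p] → ℂ} (hg : Integrable g (haarQp p)) (ξ : ℚ_[p]) :
    Integrable (fun y => g y * conj (chi (ξ * y))) (haarQp p) := by
  refine hg.mul_bdd (c := 1)
    (isUniformlyLocallyConstant_chi ξ).continuous.aestronglyMeasurable (ae_of_all _ fun y => ?_)
  rw [RCLike.norm_conj, norm_chi]

theorem tendsto_integral_compl_pBall {g : ℚ_[p] → ℂ} (hg : Integrable g (haarQp p)) :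
    Tendsto (fun n : ℤ => ∫ y in (pBall p 0 n)ᶜ, ‖g y‖ ∂(haarQp p)) atTop (𝓝 0) := by
  have h := tendsto_setIntegral_of_antitone (μ := haarQp p) (f := fun y => ‖g y‖)
    (s := fun n : ℤ => (pBall p 0 n)ᶜ) (fun n => (measurableSet_pBall 0 n).compl)
    (fun m n hmn => Set.compl_subset_compl.2 (pBall_mono 0 hmn)) ⟨0, hg.norm.integrableOn⟩
  have h0 : ⋂ n : ℤ, (pBall p (0 : ℚ_[p]) n)ᶜ = ∅ := by
    refine Set.eq_empty_of_forall_notMem fun y hy => ?_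
    obtain ⟨n, hn⟩ := exists_le_zpow (p := p) ‖y‖
    exact Set.mem_iInter.1 hy n (mem_pBall_zero.2 hn)
  rwa [h0, setIntegral_empty] at h

/-- Where `ĝ` does not vanish, off the origin, the exponential sums of `E` over large
balls vanish. -/
theorem eventually_ballSum_eq_zero {g : ℚ_[p] → ℂ} (hg : Integrable g (haarQp p))
    {E : Set ℚ_[p]} (hE : IsUniformlyDiscrete E)
    (hconv : IsConvolution (muDist E hE) (funDist g hg.locallyIntegrable)
      (funDist (fun _ => 1) (locallyIntegrable_const 1))) {ξ : ℚ_[p]} (hξ : ξ ≠ 0)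
    (hgξ : fourierFun g ξ ≠ 0) : ∀ᶠ n : ℤ in atTop, ∀ x, ballSum E ξ n x = 0 := by
  -- The factor 2 anticipates |H(x) - H(x - y)| ≤ 2 sup|H|.
  have hτ : ∀ᶠ n : ℤ in atTop, 2 * ∫ y in (pBall p 0 n)ᶜ, ‖g y‖ ∂(haarQp p) < ‖fourierFun g ξ‖ := by
    have := (tendsto_integral_compl_pBall hg).const_mul 2
    rw [mul_zero] at this
    exact this.eventually_lt_const (norm_pos_iff.2 hgξ)
  obtain ⟨k, hk⟩ := norm_eq_zpow hξ
  -- With n > -k, ξ lies outside B(0, p^{-n}), which makes the convolution identity homogeneous.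
  filter_upwards [hτ, eventually_gt_atTop (-k)] with n hn hkn
  obtain ⟨C, hC⟩ := exists_norm_ballSum_le hE n
  set H := ballSum E ξ n with hH
  have hbdd : BddAbove (Set.range fun x => ‖H x‖) := ⟨C, by rintro _ ⟨x, rfl⟩; exact hC ξ x⟩
  set S := ⨆ x, ‖H x‖ with hS
  set τ := ∫ y in (pBall p 0 n)ᶜ, ‖g y‖ ∂(haarQp p) with hτdef
  have hHS : ∀ x, ‖H x‖ ≤ S := fun x => le_ciSup hbdd x
  have hgc := integrable_mul_conj_chi hg ξ
  have hmain : ∀ x, ‖H x‖ * ‖fourierFun g ξ‖ ≤ S * (2 * τ) := by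
    intro x
    have hint : Integrable (fun y => g y * conj (chi (ξ * y)) * H (x - y)) (haarQp p) := by
      refine hgc.mul_bdd (c := C) ?_ (ae_of_all _ fun y => hC ξ _)
      exact ((continuous_ballSum E ξ n).comp
        (continuous_const.sub continuous_id)).aestronglyMeasurable
    have h0 : ∫ y, g y * conj (chi (ξ * y)) * H (x - y) ∂(haarQp p) = 0 := by
      rw [hH, integral_mul_ballSum hg hE hconv, Set.indicator_of_notMem, mul_zero]
      rw [mem_pBall_zero, hk, not_le]
      exact zpow_lt_zpow_right₀ one_lt_p (by lia)
    -- Subtracting the vanishing convolution leaves an integrand that is zero on B(0, p^n), where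
    -- H(x - y) = H(x).
    have h1 : fourierFun g ξ * H x
        = ∫ y, g y * conj (chi (ξ * y)) * (H x - H (x - y)) ∂(haarQp p) := by
      simp_rw [mul_sub]
      rw [integral_sub (hgc.mul_const _) hint, h0, sub_zero, integral_mul_const]
      rfl
    rw [← norm_mul, mul_comm, h1]
    calc ‖∫ y, g y * conj (chi (ξ * y)) * (H x - H (x - y)) ∂(haarQp p)‖
        ≤ ∫ y, (pBall p 0 n)ᶜ.indicator (fun y => ‖g y‖ * (2 * S)) y ∂(haarQp p) := by
          refine norm_integral_le_of_norm_le ((hg.norm.mul_const _).indicator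
            (measurableSet_pBall 0 n).compl) (ae_of_all _ fun y => ?_)
          by_cases hy : y ∈ pBall p 0 n
          · have : H (x - y) = H x := ballSum_eq_of_mem (by
              rw [mem_pBall, sub_sub_cancel_left, norm_neg]
              exact mem_pBall_zero.1 hy)
            rw [this, sub_self, mul_zero, norm_zero]
            exact Set.indicator_nonneg (fun y _ => mul_nonneg (norm_nonneg _)
              (mul_nonneg two_pos.le ((norm_nonneg _).trans (hHS 0)))) y
          · rw [Set.indicator_of_mem hy, norm_mul, norm_mul, RCLike.norm_conj, norm_chi, mul_one]
            refine mul_le_mul_of_nonneg_left ?_ (norm_nonneg _)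
            exact (norm_sub_le _ _).trans (by linarith [hHS x, hHS (x - y)])
      _ = S * (2 * τ) := by
          rw [integral_indicator (measurableSet_pBall 0 n).compl, integral_mul_const]
          ring
  have hS0 : 0 ≤ S := (norm_nonneg _).trans (hHS 0)
  have hpos : 0 < ‖fourierFun g ξ‖ := norm_pos_iff.2 hgξ
  have hSle : S ≤ S * (2 * τ) / ‖fourierFun g ξ‖ := ciSup_le fun x => (le_div_iff₀ hpos).2 (hmain x)
  rw [le_div_iff₀ hpos] at hSle
  -- The supremum satisfies S |ĝ(ξ)| ≤ 2τS while 2τ < |ĝ(ξ)|.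
  have hSz : S = 0 := by
    by_contra hne
    have := lt_of_le_of_ne hS0 (Ne.symm hne)
    exact hSle.not_gt (mul_lt_mul_of_pos_left hn this)
  intro x
  exact norm_le_zero_iff.1 ((hHS x).trans_eq hSz)

/-! ### The zero set of the Fourier transform of μ_E -/

theorem ballSum_eq_zero_iff {E : Set ℚ_[p]} (hE : IsUniformlyDiscrete E) (ξ : ℚ_[p]) (n : ℤ)
    (x : ℚ_[p]) :
    ballSum E ξ n x = 0 ↔ ∑ l ∈ (hE.finite_inter_pBall x n).toFinset, chi (ξ * l) = 0 := by
  rw [ballSum_eq_sum hE, ← map_sum, map_eq_zero]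

theorem ballSum_eq_zero_of_norm_eq {E : Set ℚ_[p]} (hE : IsUniformlyDiscrete E) {ξ η x : ℚ_[p]}
    {n : ℤ} (hξ : ξ ≠ 0) (hη : ‖η‖ = ‖ξ‖) (h : ballSum E ξ n x = 0) : ballSum E η n x = 0 := by
  rw [ballSum_eq_zero_iff hE] at h ⊢
  rw [← sum_chi_unit_mul_eq_zero _ (fun l => ξ * l) h (u := η / ξ) (by
    rw [norm_div, hη, div_self (norm_ne_zero_iff.2 hξ)])]
  refine Finset.sum_congr rfl fun l _ => ?_
  rw [← mul_assoc, div_mul_cancel₀ _ hξ]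

theorem fourierDist_muDist_ballIndicator {E : Set ℚ_[p]} (hE : IsUniformlyDiscrete E) (y : ℚ_[p])
    (n : ℤ) :
    fourierDist (muDist E hE) (ballIndicator y n) = (p : ℂ) ^ n * ballSum E y (-n) 0 := by
  change muDist E hE (fourierTest (ballIndicator y n)) = _
  have happ : ∀ l, ((fourierTest (ballIndicator y n) : TestFunction p) : ℚ_[p] → ℂ) l
      = (p : ℂ) ^ n * conj (chi (l * y)) * (pBall p 0 (-n)).indicator 1 l :=
    fourierFun_ballIndicator y n
  rw [muDist_eq_sum hE _ (x := 0) (n := -n), ballSum_eq_sum hE, Finset.mul_sum]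
  · refine Finset.sum_congr rfl fun l hl => ?_
    rw [Set.Finite.mem_toFinset] at hl
    rw [happ, Set.indicator_of_mem hl.2, Pi.one_apply, mul_one, mul_comm l]
  · intro l hl
    by_contra h
    rw [happ, Set.indicator_of_notMem h, mul_zero] at hl
    exact hl rfl

theorem mem_zeroSet_fourierDist_muDist {E : Set ℚ_[p]} (hE : IsUniformlyDiscrete E) {ξ : ℚ_[p]} :
    ξ ∈ zeroSet (fourierDist (muDist E hE)) ↔
      ∃ n₀ : ℤ, ∀ y ∈ pBall p ξ n₀, ∀ n ≤ n₀, ballSum E y (-n) 0 = 0 := by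
  have hpc : (p : ℂ) ≠ 0 := by exact_mod_cast (Fact.out : p.Prime).ne_zero
  simp only [zeroSet, Set.mem_ofPred_eq, fourierDist_muDist_ballIndicator, mul_eq_zero,
    zpow_ne_zero _ hpc, false_or]

/-- Away from 0 a small ball around ξ stays on the sphere through ξ, so the Galois action turns
vanishing at ξ alone into vanishing on a neighbourhood. -/
theorem mem_zeroSet_iff_eventually {E : Set ℚ_[p]} (hE : IsUniformlyDiscrete E) {ξ : ℚ_[p]}
    (hξ : ξ ≠ 0) :
    ξ ∈ zeroSet (fourierDist (muDist E hE)) ↔ ∀ᶠ n : ℤ in atTop, ballSum E ξ n 0 = 0 := by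
  rw [mem_zeroSet_fourierDist_muDist]
  constructor
  · rintro ⟨n₀, h⟩
    filter_upwards [eventually_ge_atTop (-n₀)] with n hn
    simpa using h ξ (self_mem_pBall ξ n₀) (-n) (by lia)
  · intro h
    obtain ⟨m, hm⟩ := eventually_atTop.1 h
    obtain ⟨k, hk⟩ := norm_eq_zpow hξ
    -- The bound -m makes the dual radius at least p^m; k - 1 keeps y strictly closer to ξ than 0
    -- is, so |y| = |ξ|.
    refine ⟨min (-m) (k - 1), fun y hy n hn => ?_⟩
    refine ballSum_eq_zero_of_norm_eq hE hξ ?_ (hm (-n) (by lia))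
    have hlt : ‖y - ξ‖ < ‖ξ‖ := by
      rw [hk]
      exact (mem_pBall.1 hy).trans_lt (zpow_lt_zpow_right₀ one_lt_p (by lia))
    have := Padic.add_eq_max_of_ne (q := y - ξ) (r := ξ) hlt.ne
    rwa [sub_add_cancel, max_eq_right hlt.le] at this

theorem mem_zeroSet_of_norm_eq {E : Set ℚ_[p]} (hE : IsUniformlyDiscrete E) {ξ η : ℚ_[p]}
    (hξ : ξ ≠ 0) (hη : ‖η‖ = ‖ξ‖) (h : ξ ∈ zeroSet (fourierDist (muDist E hE))) :
    η ∈ zeroSet (fourierDist (muDist E hE)) := by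
  have hη0 : η ≠ 0 := by rw [← norm_ne_zero_iff, hη]; exact norm_ne_zero_iff.2 hξ
  rw [mem_zeroSet_iff_eventually hE hξ] at h
  rw [mem_zeroSet_iff_eventually hE hη0]
  exact h.mono fun n hn => ballSum_eq_zero_of_norm_eq hE hξ hη hn

theorem zero_notMem_zeroSet {E : Set ℚ_[p]} (hE : IsUniformlyDiscrete E) (hne : E.Nonempty) :
    (0 : ℚ_[p]) ∉ zeroSet (fourierDist (muDist E hE)) := by
  rw [mem_zeroSet_fourierDist_muDist]
  rintro ⟨n₀, h⟩
  obtain ⟨l, hl⟩ := hne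
  obtain ⟨m, hm⟩ := exists_le_zpow (p := p) ‖l‖
  have h1 := h 0 (self_mem_pBall 0 n₀) (min n₀ (-m)) (min_le_left _ _)
  rw [ballSum_zero hE, Nat.cast_eq_zero, Set.ncard_eq_zero (hE.finite_inter_pBall _ _)] at h1
  have h2 : l ∈ E ∩ pBall p 0 (-min n₀ (-m)) :=
    ⟨hl, mem_pBall_zero.2 (hm.trans (zpow_le_zpow_right₀ one_lt_p.le (by lia)))⟩
  rw [h1] at h2
  exact h2

theorem ncard_inter_pBall_succ {E : Set ℚ_[p]} (hE : IsUniformlyDiscrete E) {ξ : ℚ_[p]} {k : ℤ}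
    (hξ : ‖ξ‖ = (p : ℝ) ^ k) (h : ξ ∈ zeroSet (fourierDist (muDist E hE))) (x : ℚ_[p]) :
    (E ∩ pBall p x (-k + 1)).ncard = p * (E ∩ pBall p x (-k)).ncard := by
  have hξ0 : ξ ≠ 0 := by rw [← norm_ne_zero_iff, hξ]; exact (zpow_pos p_pos _).ne'
  obtain ⟨m, hm⟩ := exists_le_zpow (p := p) ‖x‖
  obtain ⟨n, hn, hmn, hkn⟩ := (((mem_zeroSet_iff_eventually hE hξ0).1 h).and
    ((eventually_ge_atTop m).and (eventually_ge_atTop (-k + 1)))).exists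
  have hx : x ∈ pBall p 0 n := pBall_mono 0 hmn (mem_pBall_zero.2 hm)
  have hsub : ∀ j ≤ n, pBall p x j ⊆ pBall p 0 n := fun j hj => by
    rw [← pBall_eq_of_mem hx]; exact pBall_mono x hj
  -- The finite statement is applied to E ∩ B(0, p^n), with n so large that both balls around x lie
  -- in B(0, p^n).
  have hc := card_ball_succ_of_sum_eq_zero _ hξ ((ballSum_eq_zero_iff hE ξ n 0).1 hn) x
  rw [Set.Finite.coe_toFinset, Set.inter_assoc, Set.inter_assoc,
    Set.inter_eq_self_of_subset_right (hsub _ hkn),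
    Set.inter_eq_self_of_subset_right (hsub _ (by lia))] at hc
  exact_mod_cast hc

/-- Around a point of E all sufficiently small balls contain exactly one point; a zero of large norm
would force 1 = p. -/
theorem exists_norm_le_of_mem_zeroSet {E : Set ℚ_[p]} (hE : IsUniformlyDiscrete E)
    (hne : E.Nonempty) : ∃ m : ℤ, zeroSet (fourierDist (muDist E hE)) ⊆ pBall p 0 m := by
  obtain ⟨l, hl⟩ := hne
  obtain ⟨ε, hε, hsep⟩ := hE.2
  -- This gives p^{-m} ≤ ε/2, strictly below the separation ε.
  obtain ⟨m, hm⟩ := exists_le_zpow (p := p) (2 / ε)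
  refine ⟨m, fun ξ hξ => ?_⟩
  by_contra hlt
  rw [mem_pBall_zero, not_le] at hlt
  have hξ0 : ξ ≠ 0 := norm_pos_iff.1 ((zpow_pos p_pos m).trans hlt)
  obtain ⟨k, hk⟩ := norm_eq_zpow hξ0
  rw [hk, zpow_lt_zpow_iff_right₀ one_lt_p] at hlt
  have hone : ∀ j ≤ -m, (E ∩ pBall p l j).ncard = 1 := by
    intro j hj
    rw [Set.ncard_eq_one]
    refine ⟨l, Set.eq_singleton_iff_unique_mem.2 ⟨⟨hl, self_mem_pBall l j⟩, fun x hx => ?_⟩⟩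
    by_contra hxl
    have h1 := (hsep x hx.1 l hl hxl).trans (mem_pBall.1 (pBall_mono l hj hx.2))
    have h2 : 2 ≤ (p : ℝ) ^ m * ε := (div_le_iff₀ hε).1 hm
    have h3 := mul_le_mul_of_nonneg_left h1 (zpow_pos (p_pos (p := p)) m).le
    rw [← zpow_add₀ p_pos.ne', add_neg_cancel, zpow_zero] at h3
    linarith
  have hc := ncard_inter_pBall_succ hE hk hξ l
  rw [hone _ (by lia), hone _ (by lia), mul_one] at hc
  exact (Fact.out : p.Prime).one_lt.ne hc

/-! ### Consequences for the transform of f and for the counts of E -/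

theorem continuous_fourierFun {g : ℚ_[p] → ℂ} (hg : Integrable g (haarQp p)) :
    Continuous (fourierFun g) := by
  refine continuous_of_dominated (bound := fun y => ‖g y‖)
    (fun ξ => (integrable_mul_conj_chi hg ξ).aestronglyMeasurable)
    (fun ξ => ae_of_all _ fun y => ?_) hg.norm (ae_of_all _ fun y => continuous_const.mul ?_)
  · rw [norm_mul, RCLike.norm_conj, norm_chi, mul_one]
  · simpa only [mul_comm] using (isUniformlyLocallyConstant_chi y).continuous

theorem fourierFun_zero (g : ℚ_[p] → ℂ) : fourierFun g 0 = ∫ y, g y ∂(haarQp p) := by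
  simp [fourierFun, chi_of_norm_le_one]

theorem nonempty_of_isConvolution_one {g : ℚ_[p] → ℂ} (hg : Integrable g (haarQp p))
    {E : Set ℚ_[p]} (hE : IsUniformlyDiscrete E)
    (hconv : IsConvolution (muDist E hE) (funDist g hg.locallyIntegrable)
      (funDist (fun _ => 1) (locallyIntegrable_const 1))) : E.Nonempty := by
  by_contra hne
  rw [Set.not_nonempty_iff_eq_empty] at hne
  -- For empty E, testing on the indicator of ℤ_p would read 0 = 1.
  have h := integral_mul_ballSum hg hE hconv 0 0 0
  rw [Set.indicator_of_mem (self_mem_pBall 0 _)] at h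
  simp [ballSum, hne, chi_of_norm_le_one] at h

theorem mem_zeroSet_of_fourierFun_ne_zero {g : ℚ_[p] → ℂ} (hg : Integrable g (haarQp p))
    {E : Set ℚ_[p]} (hE : IsUniformlyDiscrete E)
    (hconv : IsConvolution (muDist E hE) (funDist g hg.locallyIntegrable)
      (funDist (fun _ => 1) (locallyIntegrable_const 1))) {ξ : ℚ_[p]} (hξ : ξ ≠ 0)
    (hgξ : fourierFun g ξ ≠ 0) : ξ ∈ zeroSet (fourierDist (muDist E hE)) :=
  (mem_zeroSet_iff_eventually hE hξ).2
    ((eventually_ballSum_eq_zero hg hE hconv hξ hgξ).mono fun _ h => h 0)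

theorem exists_support_fourierFun_subset {g : ℚ_[p] → ℂ} (hg : Integrable g (haarQp p))
    {E : Set ℚ_[p]} (hE : IsUniformlyDiscrete E)
    (hconv : IsConvolution (muDist E hE) (funDist g hg.locallyIntegrable)
      (funDist (fun _ => 1) (locallyIntegrable_const 1))) :
    ∃ m : ℤ, ∀ ξ, fourierFun g ξ ≠ 0 → ξ ∈ pBall p 0 m := by
  obtain ⟨m, hm⟩ := exists_norm_le_of_mem_zeroSet hE (nonempty_of_isConvolution_one hg hE hconv)
  refine ⟨m, fun ξ hξ => ?_⟩
  rcases eq_or_ne ξ 0 with rfl | h0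
  · exact self_mem_pBall 0 m
  · exact hm (mem_zeroSet_of_fourierFun_ne_zero hg hE hconv h0 hξ)

/-- Admissible radii exist because ĝ is continuous with ĝ(0) = ∫ g ≠ 0; they are bounded below
because the support of ĝ is bounded. -/
theorem exists_isLeast_radius {g : ℚ_[p] → ℂ} (hg : Integrable g (haarQp p))
    {E : Set ℚ_[p]} (hE : IsUniformlyDiscrete E)
    (hconv : IsConvolution (muDist E hE) (funDist g hg.locallyIntegrable)
      (funDist (fun _ => 1) (locallyIntegrable_const 1)))
    (hg0 : ∫ y, g y ∂(haarQp p) ≠ 0) :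
    ∃ n : ℤ, IsLeast {n : ℤ | ∀ ξ ∈ pBall p 0 (-n), fourierFun g ξ ≠ 0} n := by
  obtain ⟨m, hm⟩ := exists_support_fourierFun_subset hg hE hconv
  have hbelow : ∀ n : ℤ, (∀ ξ ∈ pBall p 0 (-n), fourierFun g ξ ≠ 0) → -m ≤ n := by
    intro n hn
    -- The point p^n has the largest norm in B(0, p^{-n}), so it detects that this ball is not too
    -- large.
    have h1 : ‖(p : ℚ_[p]) ^ n‖ = (p : ℝ) ^ (-n) := norm_zpow_p n
    have h2 := mem_pBall_zero.1 (hm _ (hn _ (mem_pBall_zero.2 h1.le)))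
    rw [h1, zpow_le_zpow_iff_right₀ one_lt_p] at h2
    lia
  have hex : ∃ n : ℤ, ∀ ξ ∈ pBall p 0 (-n), fourierFun g ξ ≠ 0 := by
    have hev := (continuous_fourierFun hg).continuousAt.eventually_ne
      (x := (0 : ℚ_[p])) (by rwa [fourierFun_zero])
    obtain ⟨ε, hε, hb⟩ := Metric.eventually_nhds_iff.1 hev
    obtain ⟨n, hn⟩ := exists_le_zpow (p := p) (2 / ε)
    refine ⟨n, fun ξ hξ => hb ?_⟩
    rw [dist_zero_right]
    refine (mem_pBall_zero.1 hξ).trans_lt ?_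
    rw [zpow_neg]
    refine inv_lt_of_inv_lt₀ hε (lt_of_lt_of_le ?_ hn)
    rw [inv_eq_one_div]
    exact div_lt_div_of_pos_right one_lt_two hε
  obtain ⟨n, hn, hmin⟩ := Int.exists_least_of_bdd ⟨-m, hbelow⟩ hex
  exact ⟨n, hn, hmin⟩

theorem zeroSet_fourierDist_muDist_eq {g : ℚ_[p] → ℂ} (hg : Integrable g (haarQp p))
    {E : Set ℚ_[p]} (hE : IsUniformlyDiscrete E)
    (hconv : IsConvolution (muDist E hE) (funDist g hg.locallyIntegrable)
      (funDist (fun _ => 1) (locallyIntegrable_const 1))) {n : ℤ}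
    (hn : ∀ ξ ∈ pBall p 0 (-n), fourierFun g ξ ≠ 0) :
    ∃ K : Set ℤ, zeroSet (fourierDist (muDist E hE)) =
      (pBall p 0 (-n) \ {0}) ∪ ⋃ k ∈ K, pSphere p 0 k := by
  -- K collects the exponents of all spheres meeting the zero set, including those already inside
  -- the ball.
  refine ⟨{k | ∃ ξ ∈ zeroSet (fourierDist (muDist E hE)), ‖ξ‖ = (p : ℝ) ^ k},
    Set.Subset.antisymm (fun ξ hξ => Or.inr ?_) (Set.union_subset ?_ ?_)⟩
  · have hξ0 : ξ ≠ 0 := by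
      rintro rfl
      exact zero_notMem_zeroSet hE (nonempty_of_isConvolution_one hg hE hconv) hξ
    obtain ⟨k, hk⟩ := norm_eq_zpow hξ0
    exact Set.mem_biUnion (x := k) ⟨ξ, hξ, hk⟩ (mem_pSphere_zero.2 hk)
  · exact fun ξ hξ => mem_zeroSet_of_fourierFun_ne_zero hg hE hconv hξ.2 (hn ξ hξ.1)
  · refine Set.iUnion₂_subset ?_
    rintro k ⟨ξ, hξ, hk⟩ η hη
    have hξ0 : ξ ≠ 0 := by rw [← norm_ne_zero_iff, hk]; exact (zpow_pos p_pos _).ne'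
    exact mem_zeroSet_of_norm_eq hE hξ0 ((mem_pSphere_zero.1 hη).trans hk.symm) hξ

/-- Every sphere of radius p^{-n} with n ≥ n₀ consists of zeros, so the count is multiplied by p at
each scale from n₀ on. The constant cannot depend on the centre, since any two centres share a large
ball. -/
theorem ncard_inter_pBall_eq_const_mul {g : ℚ_[p] → ℂ} (hg : Integrable g (haarQp p))
    {E : Set ℚ_[p]} (hE : IsUniformlyDiscrete E)
    (hconv : IsConvolution (muDist E hE) (funDist g hg.locallyIntegrable)
      (funDist (fun _ => 1) (locallyIntegrable_const 1))) {n₀ : ℤ}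
    (hn₀ : ∀ ξ ∈ pBall p 0 (-n₀), fourierFun g ξ ≠ 0) :
    ∃ c : ℝ, ∀ n, n₀ ≤ n → ∀ x, ((E ∩ pBall p x n).ncard : ℝ) = (p : ℝ) ^ n * c := by
  have hstep : ∀ n, n₀ ≤ n → ∀ x,
      (E ∩ pBall p x (n + 1)).ncard = p * (E ∩ pBall p x n).ncard := by
    intro n hn x
    have h1 : ‖(p : ℚ_[p]) ^ n‖ = (p : ℝ) ^ (-n) := norm_zpow_p n
    have h2 : (p : ℚ_[p]) ^ n ∈ pBall p 0 (-n₀) :=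
      mem_pBall_zero.2 (h1.trans_le (zpow_le_zpow_right₀ one_lt_p.le (by lia)))
    have h3 := ncard_inter_pBall_succ hE h1 (mem_zeroSet_of_fourierFun_ne_zero hg hE hconv
      (zpow_ne_zero _ p_ne_zero_padic) (hn₀ _ h2)) x
    rwa [neg_neg] at h3
  have hscale : ∀ n, n₀ ≤ n → ∀ x, ((E ∩ pBall p x n).ncard : ℝ)
      = (p : ℝ) ^ n * (((E ∩ pBall p x n₀).ncard : ℝ) / (p : ℝ) ^ n₀) := by
    intro n hn x
    induction n, hn using Int.leInduction with
    | base => rw [mul_div_cancel₀ _ (zpow_pos p_pos n₀).ne']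
    | succ n hn ih => rw [hstep n hn, Nat.cast_mul, ih, zpow_add_one₀ p_pos.ne']; ring
  refine ⟨((E ∩ pBall p 0 n₀).ncard : ℝ) / (p : ℝ) ^ n₀, fun n hn x => ?_⟩
  obtain ⟨m, hm⟩ := exists_le_zpow (p := p) ‖x‖
  -- At this scale the balls around x and around 0 coincide, which identifies their constants.
  have hx : x ∈ pBall p 0 (max m n₀) := pBall_mono 0 (le_max_left _ _) (mem_pBall_zero.2 hm)
  have h1 := hscale _ (le_max_right m n₀) x
  rw [pBall_eq_of_mem hx, hscale _ (le_max_right m n₀) 0] at h1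
  rw [hscale n hn, mul_left_cancel₀ (zpow_pos p_pos _).ne' h1]

end PadicTiling

theorem theorem3p1 (p : ℕ) [Fact p.Prime] (f : ℚ_[p] → ℝ)
    (hf_nonneg : 0 ≤ᵐ[haarQp p] f) (hf : Integrable f (haarQp p))
    (hf_pos : 0 < ∫ x, f x ∂(haarQp p))
    (E : Set ℚ_[p]) (hE : IsUniformlyDiscrete E)
    (hconv : IsConvolution (muDist E hE)
      (funDist (fun x => (f x : ℂ)) hf.ofReal.locallyIntegrable)
      (funDist (fun _ => 1) (locallyIntegrable_const 1))) :
    HasCompactSupport (fourierFun fun x => (f x : ℂ)) ∧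
    Bornology.IsBounded (zeroSet (fourierDist (muDist E hE))) ∧
    HasDensity E (1 / ∫ x, f x ∂(haarQp p)) ∧
    ∃ n_f : ℤ, IsLeast (nonvanishingRadii f) n_f ∧
      (∃ K : Set ℤ, zeroSet (fourierDist (muDist E hE)) =
        (pBall p 0 (-n_f) \ {0}) ∪ ⋃ k ∈ K, pSphere p 0 k) ∧
      ∀ n : ℤ, n_f ≤ n → ∀ ξ : ℚ_[p],
        ((E ∩ pBall p ξ n).ncard : ℝ) = (p : ℝ) ^ n * (1 / ∫ x, f x ∂(haarQp p)) := by
  have hg : Integrable (fun x => (f x : ℂ)) (haarQp p) := hf.ofReal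
  have hint : ∫ x, (f x : ℂ) ∂(haarQp p) = ((∫ x, f x ∂(haarQp p) : ℝ) : ℂ) := integral_ofReal
  have hne := nonempty_of_isConvolution_one hg hE hconv
  obtain ⟨n_f, hleast⟩ := exists_isLeast_radius hg hE hconv (by
    rw [hint]; exact_mod_cast hf_pos.ne')
  obtain ⟨c, hc⟩ := ncard_inter_pBall_eq_const_mul hg hE hconv hleast.1
  have hcval : c = 1 / ∫ x, f x ∂(haarQp p) := by
    -- At ξ = 0 the exponential sum is the count p^{n_f} c, independent of the centre, so the
    -- identity becomes p^{n_f} c ∫ f = p^{n_f}.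
    have h := integral_mul_ballSum hg hE hconv 0 0 n_f
    have hpc : (p : ℂ) ≠ 0 := by exact_mod_cast (Fact.out : p.Prime).ne_zero
    have hball : ∀ y : ℚ_[p], ballSum E 0 n_f (0 - y) = (p : ℂ) ^ n_f * c := fun y => by
      rw [ballSum_zero hE]
      have := congrArg (fun r : ℝ => (r : ℂ)) (hc n_f le_rfl (0 - y))
      push_cast at this
      exact this
    simp_rw [hball, zero_mul, chi_of_norm_le_one (norm_zero.trans_le zero_le_one : ‖(0 : ℚ_[p])‖ ≤ 1),
      map_one, mul_one] at h
    rw [integral_mul_const, hint, Set.indicator_of_mem (self_mem_pBall 0 _), Pi.one_apply] at h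
    have h' : ((c * ∫ x, f x ∂(haarQp p) : ℝ) : ℂ) = 1 := by
      apply mul_left_cancel₀ (zpow_ne_zero n_f hpc)
      rw [← h]
      push_cast
      ring
    rw [eq_div_iff hf_pos.ne']
    exact_mod_cast h'
  rw [← hcval]
  refine ⟨?_, ?_, fun x => ?_, n_f, hleast,
    zeroSet_fourierDist_muDist_eq hg hE hconv hleast.1, hc⟩
  · obtain ⟨m, hm⟩ := exists_support_fourierFun_subset hg hE hconv
    exact HasCompactSupport.intro (isCompact_pBall 0 m) fun ξ hξ => by
      by_contra h
      exact hξ (hm ξ h)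
  · obtain ⟨m, hm⟩ := exists_norm_le_of_mem_zeroSet hE hne
    exact (isCompact_pBall 0 m).isBounded.subset hm
  -- The density quotient is exactly c for every k ≥ n_f.
  · refine tendsto_const_nhds.congr' ?_
    filter_upwards [eventually_ge_atTop n_f] with k hk
    rw [haarQp_real_pBall, Set.inter_comm, hc k hk, mul_div_cancel_left₀ _ (zpow_pos p_pos k).ne']
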